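/- **Conventions.** A positional numeration system is an increasing sequence of integers $U=(U(n))_{n\ge 0}$ with $U(0)=1$; $\mathrm{rep}_U(n)$ is the greedy $U$-representation of $n\ge 0$, most significant digit first, with $\mathrm{rep}_U(0)=\varepsilon$. A tuple of integers is represented in parallel by padding the representations of its components on the left with zeros to the length of the longest one and reading them as a single word over tuples of digits. A relation on $\mathbb{N}^m$ is *recognized* by a deterministic finite automaton (DFA) over $m$-tuples of digits if the accepted words are exactly the parallel representations of the tuples in the relation. The system $U$ is *additive* if some DFA recognizes $\{(m,n,m+n): m,n\ge 0\}$. A sequence $(x(n))_{n\ge0}$ is *automatic* (in $U$) if some deterministic finite automaton with output (DFAO), on reading $\mathrm{rep}_U(n)$, outputs $x(n)$ for every $n\ge 0$. A sequence of vectors $v(n)\in\mathbb{N}^k$ is *synchronized* (in $U$) if some DFA recognizes $\{(n,v(n)_1,\dots,v(n)_k):n\ge0\}$. Let $\Sigma=\{a_1<\cdots<a_k\}\subset\mathbb{N}$ be a finite alphabet. The Parikh vector of a word $w\in\Sigma^*$ is $(|w|_{a_1},\dots,|w|_{a_k})$, where $|w|_a$ is the number of occurrences of $a$ in $w$. Two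 words $u,v\in\Sigma^*$ are *additively equivalent* if $|u|=|v|$ and $\sum_{a\in\Sigma}a|u|_a=\sum_{a\in\Sigma}a|v|_a$. The *additive complexity* $\rho^{\mathrm{add}}_{\mathbf x}(n)$ of an infinite word $\mathbf x$ over $\Sigma$ is the number of length-$n$ factors of $\mathbf x$ counted up to additive equivalence. **Theorem.** Let $U$ be an additive numeration system and let $\mathbf x$ be an infinite word over a finite alphabet $\Sigma\subset\mathbb{N}$ that is automatic in $U$. Assume that 1. the additive complexity $\rho^{\mathrm{add}}_{\mathbf x}$ is bounded above by a constant, and 2. the Parikh vectors of the length-$n$ prefixes of $\mathbf x$ ($n\ge0$) form a synchronized sequence in $U$. Then $\rho^{\mathrm{add}}_{\mathbf x}$ is automatic in $U$, and a DFAO computing it is effectively computable: there is a single partial recursive function which, for all $U,\Sigma,\mathbf x$ as above, given a bound $b$ such that all digits occurring in $U$-representations are less than $b$, the list of letters of $\Sigma$, and the transition tables of automata over the digits $0,\dots,b-1$, namely a DFA recognizing addition in $U$, a DFAO computing $\mathbf x$, and a DFA recognizing the graph of the sequence of Parikh vectors of prefixes, is defined and returns the transition table of a DFAO over the digits $0,\dots,b-1$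 that computes $\rho^{\mathrm{add}}_{\mathbf x}$. -/

import Mathlib

namespace AddCompl

/-! ## Words and additive complexity -/

/-- The length-`n` factor `x(i) x(i+1) ⋯ x(i+n-1)` of the infinite word `x`. -/
def factor (x : ℕ → ℕ) (i n : ℕ) : List ℕ := (List.range n).map fun j => x (i + j)

/-- The set of length-`n` factors of `x`. -/
def factors (x : ℕ → ℕ) (n : ℕ) : Set (List ℕ) := Set.range fun i => factor x i n

/-- Additive equivalence: same length and same total weight. The letters are natural numbers,
so the total weight `∑ a, a * |w|_a` is the sum of the letters of `w`. -/
def additiveSetoid : Setoid (List ℕ) where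
  r u v := u.length = v.length ∧ u.sum = v.sum
  iseqv :=
    ⟨fun _ => ⟨rfl, rfl⟩, fun h => ⟨h.1.symm, h.2.symm⟩,
      fun h h' => ⟨h.1.trans h'.1, h.2.trans h'.2⟩⟩

/-- Additive complexity: the number of classes of length-`n` factors under additive equivalence.
(It is only used for words over a finite alphabet, where the set counted is finite.) -/
noncomputable def additiveComplexity (x : ℕ → ℕ) (n : ℕ) : ℕ :=
  ((Quotient.mk additiveSetoid) '' factors x n).ncard

/-- The Parikh vector `(|w|_{a_0}, …, |w|_{a_{k-1}})` over the alphabet `a_0 < ⋯ < a_{k-1}`. -/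
def parikh {k : ℕ} (a : Fin k → ℕ) (w : List ℕ) : Fin k → ℕ := fun i => w.count (a i)

/-- The sequence of Parikh vectors of the prefixes of `x`. -/
def prefixParikh {k : ℕ} (a : Fin k → ℕ) (x : ℕ → ℕ) (n : ℕ) : Fin k → ℕ :=
  parikh a (factor x 0 n)

/-! ## Positional numeration systems -/

/-- A positional numeration system: an increasing sequence of integers starting with `1`. -/
structure NumSys where
  U : ℕ → ℕ
  zero : U 0 = 1
  mono : StrictMono U

/-- Greedy digits of `n` at the positions `t - 1, …, 0`, most significant digit first. -/
def greedy (U : ℕ → ℕ) : ℕ → ℕ → List ℕ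
  | 0, _ => []
  | t + 1, n => (n / U t) :: greedy U t (n % U t)

theorem NumSys.exists_lt (S : NumSys) (n : ℕ) : ∃ t, n < S.U t :=
  ⟨n + 1, lt_of_lt_of_le (Nat.lt_succ_self n) S.mono.le_apply⟩

/-- The greedy representation of `n`, most significant digit first; the number of digits is the
least `t` with `n < U t`, so `0` is represented by the empty word and the representation of a
positive integer starts with a non-zero digit. -/
def NumSys.rep (S : NumSys) (n : ℕ) : List ℕ := greedy S.U (Nat.find (S.exists_lt n)) n

/-- The word `w` over the alphabet of `m`-tuples of digits represents `v = (v_0, …, v_{m-1})` in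
parallel: the `i`-th track of `w` is the representation of `v i`, padded on the left with zeros to
the length of the longest of the `m` representations. -/
def NumSys.ParallelRep (S : NumSys) {m b : ℕ} (v : Fin m → ℕ) (w : List (Fin m → Fin b)) : Prop :=
  w.length = Finset.univ.sup (fun i => (S.rep (v i)).length) ∧
    ∀ i, w.map (fun d => (d i : ℕ)) = List.leftpad w.length 0 (S.rep (v i))

/-! ## Automata -/

/-- Deterministic automaton with output, with input letters `α`, states `σ` and outputs `β`. -/
structure DFAO (α σ β : Type) where
  step : σ → α → σ
  start : σ
  out : σ → β

/-- The output of the automaton after reading a word from left to right. -/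
def DFAO.run {α σ β : Type} (M : DFAO α σ β) (w : List α) : β := M.out (w.foldl M.step M.start)

/-- The DFAO `M` over the digits `0, …, b - 1` computes the sequence `x`: every representation is a
word over this digit alphabet, and on reading that of `n` the automaton outputs `x n`. -/
def NumSys.Computes (S : NumSys) {b : ℕ} {σ : Type} (M : DFAO (Fin b) σ ℕ) (x : ℕ → ℕ) : Prop :=
  ∀ n, ∃ w : List (Fin b), w.map (fun d => (d : ℕ)) = S.rep n ∧ M.run w = x n

/-- The DFA `A` over `m`-tuples of digits `0, …, b - 1` recognizes the relation `R`: each tuple in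
`R` has its parallel representation over this digit alphabet, and the accepted words are exactly
the parallel representations of the tuples in `R`. -/
def NumSys.Recognizes (S : NumSys) {m b : ℕ} {σ : Type} (A : DFA (Fin m → Fin b) σ)
    (R : Set (Fin m → ℕ)) : Prop :=
  (∀ v ∈ R, ∃ w ∈ A.accepts, S.ParallelRep v w) ∧ ∀ w ∈ A.accepts, ∃ v ∈ R, S.ParallelRep v w

/-- The graph of addition. -/
def additionGraph : Set (Fin 3 → ℕ) := {v | v 0 + v 1 = v 2}

/-- The graph `{(n, v(n)_0, …, v(n)_{k-1})}` of a sequence of vectors. -/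
def vectorGraph {k : ℕ} (v : ℕ → Fin k → ℕ) : Set (Fin (k + 1) → ℕ) :=
  {u | ∀ i : Fin k, u i.succ = v (u 0) i}

/-- A numeration system is additive if some DFA recognizes addition in it. -/
def NumSys.IsAdditive (S : NumSys) : Prop :=
  ∃ (b s : ℕ) (A : DFA (Fin 3 → Fin b) (Fin s)), S.Recognizes A additionGraph

/-- Automatic sequences in a numeration system. -/
def NumSys.IsAutomatic (S : NumSys) (x : ℕ → ℕ) : Prop :=
  ∃ (b s : ℕ) (M : DFAO (Fin b) (Fin s) ℕ), S.Computes M x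

/-- Synchronized sequences of vectors in a numeration system. -/
def NumSys.IsSynchronized (S : NumSys) {k : ℕ} (v : ℕ → Fin k → ℕ) : Prop :=
  ∃ (b s : ℕ) (A : DFA (Fin (k + 1) → Fin b) (Fin s)), S.Recognizes A (vectorGraph v)

/-! ## Automata as finite data -/

/-- An automaton written out as finite data: its initial state, its transition table (one row per
state, one entry per input letter), and the list of the outputs of its states. -/
abbrev Table := ℕ × List (List ℕ) × List ℕ

/-- The data of a DFAO, for a given enumeration `e` of the input letters. -/
def DFAO.table {α : Type} {c s : ℕ} (e : Fin c ≃ α) (M : DFAO α (Fin s) ℕ) : Table :=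
  ((M.start : ℕ), List.ofFn fun q => List.ofFn fun l => (M.step q (e l) : ℕ), List.ofFn M.out)

/-- The data of a DFAO over the digits `0, …, b - 1`. -/
def digitTable {b s : ℕ} (M : DFAO (Fin b) (Fin s) ℕ) : Table := M.table (Equiv.refl (Fin b))

open Classical in
/-- The data of a DFA over `m`-tuples of digits `0, …, b - 1`. The letter `d` has number
`∑ i, d i * b ^ i`; accepting states have output `1` and the others output `0`. -/
noncomputable def tupleTable {m b s : ℕ} (A : DFA (Fin m → Fin b) (Fin s)) : Table :=
  DFAO.table (finFunctionFinEquiv (m := b) (n := m)).symm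
    ⟨A.step, A.start, fun q => if q ∈ A.accept then 1 else 0⟩

end AddCompl

open AddCompl

/-!
Additive complexity counts, for every `n`, the distinct sums of the factors of length `n`. Call the
factor at position `i` new if its sum differs from those at all smaller positions; then
`additiveComplexity x n` is the number of new positions (`additiveComplexity_eq_ncard_isNew`). The
relation "`i` is new for `n`" is first-order definable from addition and the Parikh vectors of
prefixes: the prefix sums are fixed linear combinations of the Parikh vectors, and the sum of a
factor is a difference of two prefix sums. Hence so is `j < additiveComplexity x n`, for fixed `j`,
and if additive complexity is bounded, finitely many automata determine its value
(`NumSys.exists_dfao`).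

Definable relations are recognizable: `NumSys.IsRec` is closed under complement, intersection,
rearrangement of tracks and projection (`NumSys.IsRec.proj`, the subset construction), with an
explicit bound on the number of states. Automata are only required to be right on words that
represent tuples, so that complements are trivial, and the words may be padded with any number of
zeros.

For effectivity no automaton has to be constructed from its table. The state bounds yield a
computable bound on the length of the representations on which a candidate DFAO has to be compared
with additive complexity in order to be correct everywhere, and on the positions `i` that have to be
considered in this comparison (`NumSys.run_eq_of_small`, by the pigeonhole argument
`exists_short_sublist`). The bound for additive complexity itself, which is not part of the data,
is replaced by the largest output of the candidate. So the partial recursive function searches for a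
candidate together with a finite certificate of correctness: a list of the representations of
`0, 1, 2, …`, checked by the automaton for addition, on which all comparisons are made
(`Certifies`). Certified candidates are correct (`Certifies.computes`), a certificate exists
(`exists_certifies`), and being a certificate is primitive recursive (`primrecRel_certifies`).
-/

namespace AddCompl

/-! ### Representations -/

section Words

/-- Delete the leading zeros of a word. -/
def strip (w : List ℕ) : List ℕ := w.dropWhile (· == 0)

theorem strip_replicate_append (z : ℕ) (w : List ℕ) :
    strip (List.replicate z 0 ++ w) = strip w := by
  induction z with
  | zero => simp
  | succ z ih =>
    rw [List.replicate_succ, List.cons_append, ← ih]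
    simp [strip]

theorem strip_of_head?_ne {w : List ℕ} (h : w.head? ≠ some 0) : strip w = w := by
  cases w with
  | nil => rfl
  | cons a w => simp at h; simp [strip, h]

theorem strip_leftpad (L : ℕ) (w : List ℕ) : strip (List.leftpad L 0 w) = strip w :=
  strip_replicate_append _ _

theorem eq_leftpad_strip (w : List ℕ) : w = List.leftpad w.length 0 (strip w) := by
  induction w with
  | nil => rfl
  | cons a w ih =>
    by_cases h : a = 0
    · subst h
      have h1 : strip (0 :: w) = strip w := by simp [strip]
      have h2 : (strip w).length ≤ w.length := (List.dropWhile_sublist _).length_le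
      rw [h1]
      conv_lhs => rw [ih]
      simp only [List.leftpad, List.length_cons]
      rw [Nat.succ_sub h2, List.replicate_succ, List.cons_append]
    · simp [strip, h, List.leftpad]

theorem length_strip_le (w : List ℕ) : (strip w).length ≤ w.length :=
  (List.dropWhile_sublist _).length_le

theorem eq_zero_or_mem_strip {w : List ℕ} {d : ℕ} (h : d ∈ w) : d = 0 ∨ d ∈ strip w := by
  rw [eq_leftpad_strip w, List.leftpad, List.mem_append] at h
  exact h.imp List.eq_of_mem_replicate id

end Words

namespace NumSys

variable (S : NumSys)

theorem U_pos (t : ℕ) : 0 < S.U t := by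
  have := S.mono.monotone (Nat.zero_le t)
  rw [S.zero] at this
  exact this

theorem length_greedy (U : ℕ → ℕ) (t n : ℕ) : (greedy U t n).length = t := by
  induction t generalizing n with
  | zero => rfl
  | succ t ih => simp [greedy, ih]

theorem length_rep (n : ℕ) : (S.rep n).length = Nat.find (S.exists_lt n) := length_greedy _ _ _

/-- Among numbers less than `S.U t`, the `t` greedy digits determine the number. -/
theorem greedy_injOn {t m n : ℕ} (hm : m < S.U t) (hn : n < S.U t)
    (h : greedy S.U t m = greedy S.U t n) : m = n := by
  induction t generalizing m n with
  | zero => rw [S.zero] at hm hn; omega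
  | succ t ih =>
    simp only [greedy, List.cons.injEq] at h
    have := ih (Nat.mod_lt _ (S.U_pos t)) (Nat.mod_lt _ (S.U_pos t)) h.2
    rw [← Nat.div_add_mod m (S.U t), h.1, this, Nat.div_add_mod]

theorem rep_injective : Function.Injective S.rep := by
  intro m n h
  have hl := congrArg List.length h
  rw [length_rep, length_rep] at hl
  have hm := Nat.find_spec (S.exists_lt m)
  have hn := Nat.find_spec (S.exists_lt n)
  unfold rep at h
  rw [hl] at h hm
  exact S.greedy_injOn hm hn h

theorem head?_rep_ne (n : ℕ) : (S.rep n).head? ≠ some 0 := by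
  unfold rep
  rcases hf : Nat.find (S.exists_lt n) with _ | t
  · simp [greedy]
  · have : ¬ n < S.U t := Nat.find_min (S.exists_lt n) (by omega)
    have h0 : 0 < n / S.U t := Nat.div_pos (by omega) (S.U_pos t)
    rw [greedy, List.head?_cons]
    intro h
    injection h with h
    omega

@[simp] theorem strip_rep (n : ℕ) : strip (S.rep n) = S.rep n :=
  strip_of_head?_ne (S.head?_rep_ne n)

theorem length_rep_mono {m n : ℕ} (h : m ≤ n) : (S.rep m).length ≤ (S.rep n).length := by
  rw [length_rep, length_rep]
  exact Nat.find_min' _ (lt_of_le_of_lt h (Nat.find_spec (S.exists_lt n)))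

theorem lt_length_rep (t : ℕ) : t < (S.rep (S.U t)).length := by
  rw [length_rep, Nat.lt_find_iff]
  intro m hm
  exact not_lt.2 (S.mono.monotone hm)

theorem rep_zero : S.rep 0 = [] := by
  apply List.eq_nil_of_length_eq_zero
  rw [length_rep, Nat.find_eq_zero, S.zero]
  exact one_pos

theorem rep_one : S.rep 1 = [1] := by
  have : Nat.find (S.exists_lt 1) = 1 := by
    rw [Nat.find_eq_iff]
    refine ⟨?_, ?_⟩
    · have := S.mono (Nat.zero_lt_one)
      rwa [S.zero] at this
    · intro n hn
      obtain rfl : n = 0 := by omega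
      simp [S.zero]
  simp [rep, this, greedy, S.zero]

end NumSys

/-! ### Recognizing relations on padded words -/

section Tracks

variable {ι κ : Type} {b : ℕ}

/-- The `i`-th track of a word over tuples of digits. -/
def track (i : ι) (w : List (ι → Fin b)) : List ℕ := w.map fun d => (d i : ℕ)

@[simp] theorem length_track (i : ι) (w : List (ι → Fin b)) : (track i w).length = w.length := by
  simp [track]

@[simp] theorem track_append (i : ι) (w w' : List (ι → Fin b)) :
    track i (w ++ w') = track i w ++ track i w' := by simp [track]

theorem track_map_comp (f : ι → κ) (i : ι) (w : List (κ → Fin b)) :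
    track i (w.map (· ∘ f)) = track (f i) w := by simp [track]

theorem track_ext {w w' : List (ι → Fin b)} (hl : w.length = w'.length)
    (h : ∀ i, track i w = track i w') : w = w' := by
  refine List.ext_getElem hl fun p hp hp' => ?_
  funext i
  have := congrArg (fun l => l[p]?) (h i)
  simp [track, hp, hp'] at this
  exact Fin.ext this

theorem exists_tracks (L : ℕ) (u : ι → List ℕ) (hL : ∀ i, (u i).length = L)
    (hb : ∀ i, ∀ d ∈ u i, d < b) :
    ∃ w : List (ι → Fin b), w.length = L ∧ ∀ i, track i w = u i := by
  refine ⟨List.ofFn fun p : Fin L => fun i => ⟨(u i)[p]'(by simp [hL]),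
    hb i _ (List.getElem_mem _)⟩, by simp, fun i => ?_⟩
  refine List.ext_getElem (by simp [hL]) fun p hp hp' => ?_
  simp [track]

theorem track_eq_replicate {i : ι} {w : List (ι → Fin b)} (h : ∀ d ∈ w, (d i : ℕ) = 0) :
    track i w = List.replicate w.length 0 := by
  rw [List.eq_replicate_iff]
  simpa [track] using h

/-- The word `w` represents the tuple `v`: each track is the representation of the corresponding
component, preceded by any number of zeros. -/
def NumSys.Represents (S : NumSys) (w : List (ι → Fin b)) (v : ι → ℕ) : Prop :=
  ∀ i, strip (track i w) = S.rep (v i)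

namespace NumSys

variable {S : NumSys}

theorem Represents.unique {w : List (ι → Fin b)} {v v' : ι → ℕ} (h : S.Represents w v)
    (h' : S.Represents w v') : v = v' :=
  funext fun i => S.rep_injective ((h i).symm.trans (h' i))

theorem Represents.track_eq {w : List (ι → Fin b)} {v : ι → ℕ} (h : S.Represents w v) (i : ι) :
    track i w = List.leftpad w.length 0 (S.rep (v i)) := by
  have := eq_leftpad_strip (track i w)
  rwa [h i, length_track] at this

theorem Represents.length_rep_le {w : List (ι → Fin b)} {v : ι → ℕ} (h : S.Represents w v) (i : ι) :
    (S.rep (v i)).length ≤ w.length := by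
  rw [← h i, ← length_track i w]
  exact length_strip_le _

theorem Represents.comp {w : List (κ → Fin b)} {v : κ → ℕ} (h : S.Represents w v) (f : ι → κ) :
    S.Represents (w.map (· ∘ f)) (v ∘ f) := fun i => by
  rw [track_map_comp]
  exact h (f i)

theorem represents_zero_append {w₀ w : List (ι → Fin b)} {v : ι → ℕ}
    (h₀ : ∀ d ∈ w₀, ∀ i, (d i : ℕ) = 0) : S.Represents (w₀ ++ w) v ↔ S.Represents w v := by
  refine forall_congr' fun i => ?_
  rw [track_append, track_eq_replicate fun d hd => h₀ d hd i, strip_replicate_append]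

theorem exists_represents (hb : ∀ n, ∀ d ∈ S.rep n, d < b) (hb0 : 0 < b) (v : ι → ℕ) (L : ℕ)
    (hL : ∀ i, (S.rep (v i)).length ≤ L) :
    ∃ w : List (ι → Fin b), w.length = L ∧ S.Represents w v := by
  obtain ⟨w, hw, ht⟩ := exists_tracks (b := b) L (fun i => List.leftpad L 0 (S.rep (v i)))
    (fun i => by simp [hL]) (fun i d hd => by
      rw [List.leftpad, List.mem_append] at hd
      rcases hd with hd | hd
      · rw [List.eq_of_mem_replicate hd]; exact hb0
      · exact hb _ d hd)
  exact ⟨w, hw, fun i => by rw [ht, strip_leftpad, strip_rep]⟩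

theorem ParallelRep.represents {m : ℕ} {v : Fin m → ℕ} {w : List (Fin m → Fin b)}
    (h : S.ParallelRep v w) : S.Represents w v := fun i => by
  unfold track
  rw [h.2 i, strip_leftpad, strip_rep]

end NumSys

/-- The DFA that skips leading zero letters and then behaves as `Q`. -/
def padDFA [NeZero b] {σ : Type} (Q : DFA (ι → Fin b) σ) [DecidableEq (ι → Fin b)] :
    DFA (ι → Fin b) (Option σ) where
  step q d := match q with
    | none => if d = 0 then none else some (Q.step Q.start d)
    | some q => some (Q.step q d)
  start := none
  accept := {q | q.getD Q.start ∈ Q.accept}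

theorem mem_accepts_padDFA [NeZero b] {σ : Type} (Q : DFA (ι → Fin b) σ)
    [DecidableEq (ι → Fin b)] (w : List (ι → Fin b)) :
    w ∈ (padDFA Q).accepts ↔ w.dropWhile (· = 0) ∈ Q.accepts := by
  have hs : ∀ (w : List (ι → Fin b)) q,
      (padDFA Q).evalFrom (some q) w = some (Q.evalFrom q w) := by
    intro w
    induction w with
    | nil => intro q; rfl
    | cons d w ih => intro q; exact ih _
  have hn : ((padDFA Q).evalFrom none w).getD Q.start =
      Q.evalFrom Q.start (w.dropWhile (· = 0)) := by
    induction w with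
    | nil => rfl
    | cons d w ih =>
      by_cases h : d = 0
      · have : (padDFA Q).step none d = none := if_pos h
        rw [DFA.evalFrom_cons, this, ih]
        simp [h]
      · have : (padDFA Q).step none d = some (Q.step Q.start d) := if_neg h
        rw [DFA.evalFrom_cons, this, hs]
        simp [h]
  change ((padDFA Q).evalFrom none w).getD Q.start ∈ Q.accept ↔ _
  rw [hn]
  rfl

theorem NumSys.represents_dropWhile [NeZero b] {S : NumSys} [DecidableEq (ι → Fin b)]
    {w : List (ι → Fin b)} {v : ι → ℕ} :
    S.Represents (w.dropWhile (· = 0)) v ↔ S.Represents w v := by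
  conv_rhs => rw [← List.takeWhile_append_dropWhile (p := (· = 0)) (l := w)]
  rw [NumSys.represents_zero_append]
  intro d hd i
  have := List.mem_takeWhile_imp hd
  simp at this
  simp [this]

/-- A word without leading zero letter is the shortest word representing its tuple. -/
theorem NumSys.Represents.length_le {S : NumSys} {w w' : List (ι → Fin b)} {v : ι → ℕ}
    (h : S.Represents w v) (h' : S.Represents w' v)
    (hz : ∀ d, w'.head? = some d → ∃ i, (d i : ℕ) ≠ 0) : w'.length ≤ w.length := by
  by_contra hlt
  cases w' with
  | nil => simp at hlt
  | cons d w' =>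
    obtain ⟨i, hi⟩ := hz d rfl
    have h1 : strip (track i (d :: w')) = track i (d :: w') := by
      apply strip_of_head?_ne
      simp [track, hi]
    have h2 := h.length_rep_le i
    rw [← h' i, h1, length_track] at h2
    omega

theorem NumSys.ParallelRep.head {S : NumSys} {m : ℕ} {v : Fin m → ℕ} {w : List (Fin m → Fin b)}
    (h : S.ParallelRep v w) (d : Fin m → Fin b) (hd : w.head? = some d) :
    ∃ i, (d i : ℕ) ≠ 0 := by
  cases w with
  | nil => simp at hd
  | cons d' w =>
    obtain rfl : d' = d := by simpa using hd
    have hm : (Finset.univ : Finset (Fin m)).Nonempty := by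
      by_contra hne
      have := h.1
      rw [Finset.not_nonempty_iff_eq_empty.1 hne] at this
      simp at this
    obtain ⟨i, -, hi⟩ := Finset.exists_mem_eq_sup _ hm (fun i => (S.rep (v i)).length)
    have h2 := h.2 i
    rw [h.1, hi] at h2
    refine ⟨i, fun h0 => S.head?_rep_ne (v i) ?_⟩
    rw [List.leftpad, Nat.sub_self, List.replicate_zero, List.nil_append] at h2
    rw [← h2]
    simp [h0]

theorem NumSys.ParallelRep.eq_dropWhile [NeZero b] {S : NumSys} {m : ℕ} {v : Fin m → ℕ}
    {w w' : List (Fin m → Fin b)} (h : S.ParallelRep v w) (h' : S.Represents w' v) :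
    w = w'.dropWhile (· = 0) := by
  have h1 := h.represents
  have h2 := NumSys.represents_dropWhile.2 h'
  have hl : w.length = (w'.dropWhile (· = 0)).length := by
    refine le_antisymm (h2.length_le h1 h.head) (h1.length_le h2 fun d hd => ?_)
    have := List.head?_dropWhile_not (fun x : Fin m → Fin b => decide (x = 0)) w'
    rw [hd] at this
    by_contra hc
    push Not at hc
    simp at this
    exact this (funext fun i => Fin.ext (by simp [hc]))
  exact track_ext hl fun i => by rw [h1.track_eq, h2.track_eq, hl]

end Tracks

section Recognition

variable {ι κ : Type} {S : NumSys} {b : ℕ}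

/-- Some DFA with at most `s` states decides the relation `R` on words that represent tuples. Words
whose tracks are not padded greedy representations may be accepted or rejected. -/
def NumSys.IsRec (S : NumSys) (b : ℕ) (R : Set (ι → ℕ)) (s : ℕ) : Prop :=
  ∃ (σ : Type) (_ : Fintype σ) (A : DFA (ι → Fin b) σ), Fintype.card σ ≤ s ∧
    ∀ w v, S.Represents w v → (w ∈ A.accepts ↔ v ∈ R)

/-- All greedy representations are words over the digits `0, …, b - 1`, and some DFA with at most
`s` states recognizes their paddings by leading zeros. -/
def NumSys.HasValid (S : NumSys) (b s : ℕ) : Prop :=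
  (∀ n, ∀ d ∈ S.rep n, d < b) ∧
  ∃ (σ : Type) (_ : Fintype σ) (V : DFA (Fin b) σ), Fintype.card σ ≤ s ∧
    ∀ w : List (Fin b), w ∈ V.accepts ↔ ∃ n, strip (w.map Fin.val) = S.rep n

namespace NumSys

theorem IsRec.compl {R : Set (ι → ℕ)} {s : ℕ} (h : S.IsRec b R s) : S.IsRec b Rᶜ s := by
  obtain ⟨σ, _, A, hs, hA⟩ := h
  exact ⟨σ, inferInstance, Aᶜ, hs, fun w v hw => by
    rw [DFA.accepts_compl]; exact not_congr (hA w v hw)⟩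

theorem IsRec.inter {R R' : Set (ι → ℕ)} {s s' : ℕ} (h : S.IsRec b R s) (h' : S.IsRec b R' s') :
    S.IsRec b (R ∩ R') (s * s') := by
  obtain ⟨σ, _, A, hs, hA⟩ := h
  obtain ⟨σ', _, A', hs', hA'⟩ := h'
  refine ⟨σ × σ', inferInstance, A.inter A', ?_, fun w v hw => ?_⟩
  · rw [Fintype.card_prod]; exact Nat.mul_le_mul hs hs'
  · rw [DFA.accepts_inter]
    exact and_congr (hA w v hw) (hA' w v hw)

theorem IsRec.reindex {R : Set (ι → ℕ)} {s : ℕ} (h : S.IsRec b R s) (f : ι → κ) :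
    S.IsRec b {v : κ → ℕ | v ∘ f ∈ R} s := by
  obtain ⟨σ, _, A, hs, hA⟩ := h
  refine ⟨σ, inferInstance, A.comap (· ∘ f), hs, fun w v hw => ?_⟩
  rw [DFA.accepts_comap]
  exact hA _ _ (hw.comp f)

theorem IsRec.congr {R R' : Set (ι → ℕ)} {s s' : ℕ} (h : S.IsRec b R s)
    (hR : ∀ v, v ∈ R' ↔ v ∈ R) (hs : s ≤ s') : S.IsRec b R' s' := by
  obtain ⟨σ, i, A, hc, hA⟩ := h
  exact ⟨σ, i, A, hc.trans hs, fun w v hw => (hA w v hw).trans (hR v).symm⟩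

end NumSys

/-- The power of a DFA: it runs a copy of `V` on every track, and accepts if all of them accept. -/
def piDFA {σ : Type} (κ : Type) (V : DFA (Fin b) σ) : DFA (κ → Fin b) (κ → σ) where
  step q d := fun j => V.step (q j) (d j)
  start := fun _ => V.start
  accept := {q | ∀ j, q j ∈ V.accept}

theorem mem_accepts_piDFA {σ : Type} (V : DFA (Fin b) σ) (w : List (κ → Fin b)) :
    w ∈ (piDFA κ V).accepts ↔ ∀ j, w.map (· j) ∈ V.accepts := by
  have : ∀ (w : List (κ → Fin b)) q j,
      (piDFA κ V).evalFrom q w j = V.evalFrom (q j) (w.map (· j)) := by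
    intro w
    induction w with
    | nil => intro q j; rfl
    | cons d w ih => intro q j; exact ih _ j
  exact forall_congr' fun j => by rw [this]; rfl

/-- The DFA for the projection of a relation to the tracks `ι`: the subset construction, in which
the tracks `κ` are guessed. Its initial state takes care of representations on the tracks `κ` that
are longer than those on the tracks `ι`. -/
def projDFA [NeZero b] {σ : Type} (A : DFA (ι ⊕ κ → Fin b) σ) : DFA (ι → Fin b) (Set σ) where
  step Q d := {q | ∃ p ∈ Q, ∃ e : κ → Fin b, A.step p (Sum.elim d e) = q}
  start := {q | ∃ w, (∀ d ∈ w, ∀ i, (d (Sum.inl i) : ℕ) = 0) ∧ A.eval w = q}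
  accept := {Q | ∃ q ∈ Q, q ∈ A.accept}

theorem mem_eval_projDFA [NeZero b] {σ : Type} (A : DFA (ι ⊕ κ → Fin b) σ) (w : List (ι → Fin b))
    (q : σ) : q ∈ (projDFA A).eval w ↔ ∃ w₀ w₁, (∀ d ∈ w₀, ∀ i, (d (Sum.inl i) : ℕ) = 0) ∧
      w₁.map (· ∘ Sum.inl) = w ∧ A.eval (w₀ ++ w₁) = q := by
  induction w using List.reverseRecOn generalizing q with
  | nil =>
    constructor
    · rintro ⟨w₀, h, h'⟩
      exact ⟨w₀, [], h, rfl, by simpa using h'⟩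
    · rintro ⟨w₀, w₁, h, h1, h'⟩
      obtain rfl : w₁ = [] := by simpa using h1
      exact ⟨w₀, h, by simpa using h'⟩
  | append_singleton w d ih =>
    rw [DFA.eval_append_singleton]
    constructor
    · rintro ⟨p, hp, e, rfl⟩
      obtain ⟨w₀, w₁, h0, h1, rfl⟩ := (ih p).1 hp
      refine ⟨w₀, w₁ ++ [Sum.elim d e], h0, by simp [h1], ?_⟩
      rw [← List.append_assoc, DFA.eval_append_singleton]
    · rintro ⟨w₀, w₁, h0, h1, rfl⟩
      obtain ⟨w₂, w₃, rfl, h2, h3⟩ := List.map_eq_append_iff.1 h1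
      obtain ⟨d', rfl, h4⟩ := List.map_eq_singleton_iff.1 h3
      refine ⟨A.eval (w₀ ++ w₂), (ih _).2 ⟨w₀, w₂, h0, h2, rfl⟩, d' ∘ Sum.inr, ?_⟩
      rw [← List.append_assoc, DFA.eval_append_singleton, ← h4, Sum.elim_comp_inl_inr]

theorem map_inl_zipWith_elim (w : List (ι → Fin b)) (u : List (κ → Fin b))
    (h : w.length = u.length) :
    (List.zipWith Sum.elim w u).map (· ∘ Sum.inl) = w := by
  induction w generalizing u with
  | nil => rfl
  | cons d w ih =>
    cases u with
    | nil => simp at h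
    | cons e u => simp at h; simp [ih u h]

theorem map_inr_zipWith_elim (w : List (ι → Fin b)) (u : List (κ → Fin b))
    (h : w.length = u.length) :
    (List.zipWith Sum.elim w u).map (· ∘ Sum.inr) = u := by
  induction w generalizing u with
  | nil => cases u with
    | nil => rfl
    | cons e u => simp at h
  | cons d w ih =>
    cases u with
    | nil => simp at h
    | cons e u => simp at h; simp [ih u h]

namespace NumSys

theorem IsRec.proj [NeZero b] [Fintype κ] {R : Set (ι ⊕ κ → ℕ)} {s sV : ℕ}
    (h : S.IsRec b R s) (hV : S.HasValid b sV) :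
    S.IsRec b {v : ι → ℕ | ∃ u : κ → ℕ, Sum.elim v u ∈ R} (2 ^ (s * sV ^ Fintype.card κ)) := by
  classical
  obtain ⟨σ, _, A, hs, hA⟩ := h
  obtain ⟨hb, τ, _, V, hs', hV⟩ := hV
  -- `A` is only reliable on representations, so the guessed tracks are checked to be valid
  let B := A.inter ((piDFA κ V).comap (· ∘ Sum.inr : (ι ⊕ κ → Fin b) → _))
  have hB : ∀ w, w ∈ B.accepts ↔ w ∈ A.accepts ∧ ∃ u, S.Represents (w.map (· ∘ Sum.inr)) u := by
    intro w
    rw [DFA.accepts_inter, DFA.accepts_comap]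
    refine and_congr Iff.rfl ?_
    refine (mem_accepts_piDFA V _).trans ?_
    simp only [hV]
    rw [Classical.skolem]
    simp [Represents, track, Function.comp_def]
  refine ⟨Set (σ × (κ → τ)), inferInstance, projDFA B, ?_, fun w v hw => ?_⟩
  · rw [Fintype.card_set, Fintype.card_prod, Fintype.card_fun]
    exact Nat.pow_le_pow_right two_pos (Nat.mul_le_mul hs (Nat.pow_le_pow_left hs' _))
  have hacc : w ∈ (projDFA B).accepts ↔ ∃ w₀ w₁, (∀ d ∈ w₀, ∀ i, (d (Sum.inl i) : ℕ) = 0) ∧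
      w₁.map (· ∘ Sum.inl) = w ∧ w₀ ++ w₁ ∈ B.accepts := by
    rw [DFA.mem_accepts]
    constructor
    · rintro ⟨q, hq, hq'⟩
      obtain ⟨w₀, w₁, h0, h1, rfl⟩ := (mem_eval_projDFA B w q).1 hq
      exact ⟨w₀, w₁, h0, h1, hq'⟩
    · rintro ⟨w₀, w₁, h0, h1, h2⟩
      exact ⟨_, (mem_eval_projDFA B w _).2 ⟨w₀, w₁, h0, h1, rfl⟩, h2⟩
  have hrep : ∀ (W : List (ι ⊕ κ → Fin b)) u, S.Represents (W.map (· ∘ Sum.inl)) v →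
      S.Represents (W.map (· ∘ Sum.inr)) u → S.Represents W (Sum.elim v u) := by
    rintro W u h1 h2 (i | j)
    · have := h1 i
      rwa [track_map_comp] at this
    · have := h2 j
      rwa [track_map_comp] at this
  rw [hacc]
  constructor
  · rintro ⟨w₀, w₁, h0, h1, h2⟩
    obtain ⟨h3, u, h4⟩ := (hB _).1 h2
    refine ⟨u, (hA _ _ (hrep _ _ ?_ h4)).1 h3⟩
    rw [List.map_append, represents_zero_append, h1]
    · exact hw
    · intro d hd i
      obtain ⟨d', hd', rfl⟩ := List.mem_map.1 hd
      exact h0 d' hd' i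
  · rintro ⟨u, hu⟩
    -- `L` additional leading letters make room for the representations of the components of `u`
    let L := Finset.univ.sup fun j => (S.rep (u j)).length
    obtain ⟨w', hl, hw'⟩ := exists_represents (b := b) hb (NeZero.pos b) u (L + w.length)
      fun j => (Finset.le_sup (f := fun j => (S.rep (u j)).length) (Finset.mem_univ j)).trans
        (Nat.le_add_right _ _)
    have hz0 : (List.replicate L (0 : ι → Fin b)).length = (w'.take L).length := by simp [hl]
    have hz1 : w.length = (w'.drop L).length := by simp [hl]
    have h0 : ∀ d ∈ List.replicate L (0 : ι → Fin b), ∀ i, (d i : ℕ) = 0 := by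
      intro d hd i
      rw [List.eq_of_mem_replicate hd]; rfl
    refine ⟨List.zipWith Sum.elim (List.replicate L (0 : ι → Fin b)) (w'.take L),
      List.zipWith Sum.elim w (w'.drop L), ?_, map_inl_zipWith_elim _ _ hz1, ?_⟩
    · intro d hd i
      have := List.mem_map_of_mem (f := (· ∘ Sum.inl)) hd
      rw [map_inl_zipWith_elim _ _ hz0] at this
      exact h0 _ this i
    · have hr : S.Represents (List.map (· ∘ Sum.inr)
          (List.zipWith Sum.elim (List.replicate L (0 : ι → Fin b)) (w'.take L) ++
            List.zipWith Sum.elim w (w'.drop L))) u := by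
        rw [List.map_append, map_inr_zipWith_elim _ _ hz0, map_inr_zipWith_elim _ _ hz1,
          List.take_append_drop]
        exact hw'
      refine (hB _).2 ⟨(hA _ _ (hrep _ u ?_ hr)).2 hu, u, hr⟩
      rw [List.map_append, map_inl_zipWith_elim _ _ hz0, map_inl_zipWith_elim _ _ hz1,
        represents_zero_append h0]
      exact hw

theorem Recognizes.mem_padDFA [NeZero b] {m : ℕ} {σ : Type} {Q : DFA (Fin m → Fin b) σ}
    {R : Set (Fin m → ℕ)} (h : S.Recognizes Q R) (w : List (Fin m → Fin b)) :
    w ∈ (padDFA Q).accepts ↔ ∃ v ∈ R, S.Represents w v := by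
  rw [mem_accepts_padDFA]
  constructor
  · intro hw
    obtain ⟨v, hv, hp⟩ := h.2 _ hw
    exact ⟨v, hv, represents_dropWhile.1 hp.represents⟩
  · rintro ⟨v, hv, hw⟩
    obtain ⟨w', hw', hp⟩ := h.1 v hv
    rwa [← hp.eq_dropWhile hw]

theorem Recognizes.isRec [NeZero b] {m s : ℕ} {Q : DFA (Fin m → Fin b) (Fin s)}
    {R : Set (Fin m → ℕ)} (h : S.Recognizes Q R) : S.IsRec b R (s + 1) := by
  refine ⟨Option (Fin s), inferInstance, padDFA Q, by simp, fun w v hw => ?_⟩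
  rw [h.mem_padDFA]
  exact ⟨fun ⟨v', hv', h'⟩ => hw.unique h' ▸ hv', fun hv => ⟨v, hv, hw⟩⟩

theorem Recognizes.digit_lt {m : ℕ} {σ : Type} {Q : DFA (Fin m → Fin b) σ} {R : Set (Fin m → ℕ)}
    (h : S.Recognizes Q R) {v : Fin m → ℕ} (hv : v ∈ R) (i : Fin m) : ∀ d ∈ S.rep (v i), d < b := by
  obtain ⟨w, -, hp⟩ := h.1 v hv
  intro d hd
  rw [← hp.represents i] at hd
  obtain ⟨e, -, rfl⟩ := List.mem_map.1 ((List.dropWhile_sublist _).subset hd)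
  exact (e i).2

/-- The recognized relation does not depend on the digit alphabet that the DFA reads, provided it
contains all digits of representations. -/
theorem IsRec.changeBase {b' s : ℕ} {R : Set (ι → ℕ)} (h : S.IsRec b R s)
    (hb : ∀ n, ∀ d ∈ S.rep n, d < b) (hb0 : 0 < b) : S.IsRec b' R s := by
  obtain ⟨σ, _, A, hs, hA⟩ := h
  -- digits outside the alphabet do not occur in words that represent tuples
  let c : (ι → Fin b') → (ι → Fin b) := fun d i => ⟨min (d i) (b - 1), by omega⟩
  refine ⟨σ, inferInstance, A.comap c, hs, fun w v hw => ?_⟩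
  rw [DFA.accepts_comap]
  refine hA _ _ fun i => ?_
  rw [← hw i]
  congr 1
  unfold track
  rw [List.map_map]
  refine List.map_congr_left fun d hd => ?_
  have hm : (d i : ℕ) ∈ track i w := List.mem_map.2 ⟨d, hd, rfl⟩
  have : (d i : ℕ) < b := by
    rcases eq_zero_or_mem_strip hm with h0 | h0
    · omega
    · rw [hw i] at h0
      exact hb _ _ h0
  simp only [Function.comp_apply, c]
  omega

theorem Recognizes.hasValid [NeZero b] {s : ℕ} {A : DFA (Fin 3 → Fin b) (Fin s)}
    (h : S.Recognizes A additionGraph) : S.HasValid b (s + 1) := by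
  -- a word `w` represents some `n` if and only if the triple of words `w, 0⋯0, w` is accepted
  refine ⟨fun n => h.digit_lt (v := ![n, 0, n]) (by simp [additionGraph]) 0, Option (Fin s),
    inferInstance, (padDFA A).comap fun d => ![d, 0, d], by simp, fun w => ?_⟩
  rw [DFA.accepts_comap]
  refine (h.mem_padDFA _).trans ?_
  have h02 : ∀ i : Fin 3, track i (w.map fun d => (![d, 0, d] : Fin 3 → Fin b)) =
      if i = 1 then List.replicate w.length 0 else w.map Fin.val := by
    intro i
    fin_cases i <;> simp [track, Function.comp_def]
  have hz : strip (List.replicate w.length 0) = S.rep 0 := by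
    have := strip_replicate_append w.length []
    rw [List.append_nil] at this
    rw [this, rep_zero]; rfl
  constructor
  · rintro ⟨v, -, hv⟩
    have := hv 0
    rw [h02] at this
    exact ⟨v 0, by simpa using this⟩
  · rintro ⟨n, hn⟩
    refine ⟨![n, 0, n], by simp [additionGraph], fun i => ?_⟩
    rw [h02]
    fin_cases i
    · simpa using hn
    · simpa using hz
    · simpa using hn

end NumSys

/-! ### Small words -/

/-- A word can be shortened to at most as many letters as there are states, without changing the
state to which it leads. -/
theorem exists_short_sublist {α σ : Type} [Fintype σ] (M : DFA α σ) (q : σ) (w : List α) :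
    ∃ w' : List α, w'.Sublist w ∧ w'.length ≤ Fintype.card σ ∧
      M.evalFrom q w' = M.evalFrom q w := by
  induction hn : w.length using Nat.strong_induction_on generalizing w with
  | _ n ih =>
    by_cases hl : w.length ≤ Fintype.card σ
    · exact ⟨w, List.Sublist.refl w, hl, rfl⟩
    · obtain ⟨p, x, y, z, rfl, -, hy, hx, hp, hz⟩ :=
        M.evalFrom_split (s := q) (Nat.le_of_not_le hl) rfl
      have hy' : 0 < y.length := List.length_pos_iff.2 hy
      have hlt : (x ++ z).length < n := by
        simp only [List.length_append] at hn ⊢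
        omega
      obtain ⟨w', h1, h2, h3⟩ := ih _ hlt (x ++ z) rfl
      refine ⟨w', h1.trans ?_, h2, ?_⟩
      · exact List.Sublist.append (List.sublist_append_left x y) (List.Sublist.refl z)
      · rw [h3, DFA.evalFrom_of_append, hx, hz]

end Recognition


/-! ### The relations behind additive complexity -/

/-- The factor of `x` of length `n` at `i` is not additively equivalent to an earlier one. -/
def IsNew (x : ℕ → ℕ) (n i : ℕ) : Prop := ∀ i' < i, (factor x i' n).sum ≠ (factor x i n).sum

/-- The factor of length `n` at `i` is new, and at least `j` factors of this length at smaller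
positions are new. -/
def NewAfter (x : ℕ → ℕ) (n : ℕ) : ℕ → ℕ → Prop
  | 0, i => IsNew x n i
  | j + 1, i => IsNew x n i ∧ ∃ i' < i, NewAfter x n j i'

/-- Number of states for a sum of `r` components of a synchronized sequence of vectors. -/
def sumBound (sA sP k r : ℕ) : ℕ :=
  Nat.rec sA (fun _ s => 2 ^ (s * (sP * sA) * sA ^ (k + 1))) r

/-- Number of states for `IsNew`, when prefix sums are recognized with `s` states. -/
def newBound (sA s : ℕ) : ℕ := 2 ^ (sA ^ 6 * s ^ 4 * sA ^ 9)

/-- Number of states for `NewAfter`, when `IsNew` is recognized with `s` states. -/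
def afterBound (sA s j : ℕ) : ℕ :=
  Nat.rec s (fun _ t => s * 2 ^ (t * (sA * sA) * sA ^ 2)) j

namespace NumSys

variable {S : NumSys} {b sA : ℕ}

theorem isRec_sum [NeZero b] {k sP : ℕ} {p : ℕ → Fin k → ℕ} (hA : S.IsRec b additionGraph sA)
    (hV : S.HasValid b sA) (hP : S.IsRec b (vectorGraph p) sP) (l : List (Fin k)) :
    S.IsRec b {v : Fin 2 → ℕ | v 1 = (l.map (p (v 0))).sum} (sumBound sA sP k l.length) := by
  induction l with
  | nil =>
    -- `s + s = s` expresses `s = 0`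
    refine (hA.reindex ![1, 1, 1]).congr (fun v => ?_) le_rfl
    simp [additionGraph]
  | cons c l ih =>
    -- the tracks `inr` hold the sum over `l`, followed by the vector `p (v 0)`
    refine (((ih.reindex ![.inl 0, .inr 0]).inter ((hP.reindex
      (Fin.cons (.inl 0) fun i => .inr i.succ)).inter
      (hA.reindex (![.inr 0, .inr c.succ, .inl 1] : Fin 3 → Fin 2 ⊕ Fin (k + 1))))).proj
      hV).congr (fun v => ?_) (by simp [sumBound])
    simp only [Set.mem_ofPred_eq, Set.mem_inter_iff, additionGraph, vectorGraph,
      Function.comp_apply, Matrix.cons_val_zero, Matrix.cons_val_one, Matrix.cons_val, Sum.elim_inl,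
      Sum.elim_inr, Fin.cons_zero, Fin.cons_succ, List.map_cons, List.sum_cons]
    constructor
    · intro h
      refine ⟨Fin.cons (l.map (p (v 0))).sum (p (v 0)), ?_, fun i => ?_, ?_⟩
      · simp
      · simp
      · simp only [Fin.cons_zero, Fin.cons_succ]
        omega
    · rintro ⟨u, h1, h2, h3⟩
      rw [← h3, h1, h2, add_comm]

theorem isRec_isNew [NeZero b] {x : ℕ → ℕ} {s : ℕ} (hA : S.IsRec b additionGraph sA)
    (hV : S.HasValid b sA) (hs : S.IsRec b {v : Fin 2 → ℕ | v 1 = (factor x 0 (v 0)).sum} s) :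
    S.IsRec b {v : Fin 2 → ℕ | IsNew x (v 0) (v 1)} (newBound sA s) := by
  -- the complement: with `n = v 0`, `i = v 1` and `g` the prefix sums, there are
  -- `i', d, i + n, i' + n, g i, g i', g (i + n), g (i' + n), y` with `i' + d = i`, `d ≠ 0` and
  -- `g (i + n) + g i' = y = g (i' + n) + g i`
  let t : Fin 9 → Fin 2 ⊕ Fin 9 := .inr
  have h := (((hA.reindex ![t 0, t 1, .inl 1]).inter ((hA.reindex ![t 1, t 1, t 1]).compl.inter
    ((hA.reindex ![.inl 1, .inl 0, t 2]).inter ((hA.reindex ![t 0, .inl 0, t 3]).inter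
    ((hA.reindex ![t 6, t 5, t 8]).inter ((hA.reindex ![t 7, t 4, t 8]).inter
    ((hs.reindex ![.inl 1, t 4]).inter ((hs.reindex ![t 0, t 5]).inter
    ((hs.reindex ![t 2, t 6]).inter (hs.reindex ![t 3, t 7])))))))))).proj hV).compl
  refine h.congr (fun v => ?_) (Nat.pow_le_pow_right two_pos (le_of_eq ?_))
  · have hfac : ∀ i n, (factor x 0 (i + n)).sum = (factor x 0 i).sum + (factor x i n).sum := by
      intro i n
      simp [factor, List.range_add, Function.comp_def]
    simp only [Set.mem_compl_iff, Set.mem_ofPred_eq, Set.mem_inter_iff, additionGraph,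
      Function.comp_apply, Matrix.cons_val_zero, Matrix.cons_val_one, Matrix.cons_val, Sum.elim_inl,
      Sum.elim_inr, t, IsNew]
    rw [← not_iff_not, not_not]
    push Not
    constructor
    · rintro ⟨i, hi, he⟩
      refine ⟨![i, v 1 - i, v 1 + v 0, i + v 0, (factor x 0 (v 1)).sum, (factor x 0 i).sum,
        (factor x 0 (v 1 + v 0)).sum, (factor x 0 (i + v 0)).sum,
        (factor x 0 (v 1 + v 0)).sum + (factor x 0 i).sum], ?_⟩
      have h1 := hfac i (v 0)
      have h2 := hfac (v 1) (v 0)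
      simp
      omega
    · rintro ⟨u, h0, h1, h2, h3, h4, h5, h6, h7, h8, h9⟩
      refine ⟨u 0, by omega, ?_⟩
      have h10 := hfac (u 0) (v 0)
      have h11 := hfac (v 1) (v 0)
      rw [h3] at h10
      rw [h2] at h11
      omega
  · simp only [Fintype.card_fin]
    ring

theorem isRec_newAfter [NeZero b] {x : ℕ → ℕ} {s : ℕ} (hA : S.IsRec b additionGraph sA)
    (hV : S.HasValid b sA) (hs : S.IsRec b {v : Fin 2 → ℕ | IsNew x (v 0) (v 1)} s) (j : ℕ) :
    S.IsRec b {v : Fin 2 → ℕ | NewAfter x (v 0) j (v 1)} (afterBound sA s j) := by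
  induction j with
  | zero => exact hs
  | succ j ih =>
    let t : Fin 2 → Fin 2 ⊕ Fin 2 := .inr
    refine (hs.inter (((ih.reindex ![.inl 0, t 0]).inter ((hA.reindex ![t 0, t 1, .inl 1]).inter
      (hA.reindex ![t 1, t 1, t 1]).compl)).proj hV)).congr (fun v => ?_) (by simp [afterBound])
    simp only [NewAfter, Set.mem_compl_iff, Set.mem_ofPred_eq, Set.mem_inter_iff, additionGraph,
      Function.comp_apply, Matrix.cons_val_zero, Matrix.cons_val_one, Matrix.cons_val, Sum.elim_inl,
      Sum.elim_inr, t]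
    refine and_congr Iff.rfl ⟨?_, ?_⟩
    · rintro ⟨i, hi, h⟩
      refine ⟨![i, v 1 - i], ?_⟩
      simp [h]
      omega
    · rintro ⟨u, h1, h2, h3⟩
      exact ⟨u 0, by omega, h1⟩

theorem isRec_exists [NeZero b] {R : ℕ → ℕ → Prop} {s : ℕ} (hV : S.HasValid b sA)
    (hs : S.IsRec b {v : Fin 2 → ℕ | R (v 0) (v 1)} s) :
    S.IsRec b {v : Fin 1 → ℕ | ∃ i, R (v 0) i} (2 ^ (s * sA)) := by
  let t : Fin 1 → Fin 1 ⊕ Fin 1 := .inr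
  refine ((hs.reindex ![.inl 0, t 0]).proj hV).congr (fun v => ?_) (by simp)
  simp only [Set.mem_ofPred_eq, Function.comp_apply, Matrix.cons_val_zero, Matrix.cons_val_one,
    Sum.elim_inl, Sum.elim_inr, t]
  exact ⟨fun ⟨i, h⟩ => ⟨fun _ => i, h⟩, fun ⟨u, h⟩ => ⟨_, h⟩⟩

theorem represents_single {w : List (Fin b)} {n : ℕ} :
    S.Represents (w.map fun d => fun _ : Fin 1 => d) (fun _ => n) ↔
      strip (w.map Fin.val) = S.rep n := by
  simp [Represents, track, Function.comp_def]

/-- If the second component is related to the first at all, then it may be chosen with a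
representation that is only boundedly longer. -/
theorem IsRec.exists_small [NeZero b] {R : ℕ → ℕ → Prop} {s : ℕ} (hV : S.HasValid b sA)
    (hs : S.IsRec b {v : Fin 2 → ℕ | R (v 0) (v 1)} s) {n i : ℕ} (h : R n i) :
    ∃ i', R n i' ∧ (S.rep i').length ≤ (S.rep n).length + s * sA := by
  obtain ⟨hb, τ, _, V, hcV, hV⟩ := hV
  obtain ⟨σ, _, A, hcA, hA⟩ := hs
  rcases le_total (S.rep i).length (S.rep n).length with hl | hl
  · exact ⟨i, h, by omega⟩
  obtain ⟨w, hw, hr⟩ := exists_represents (S := S) hb (NeZero.pos b) ![n, i] (S.rep i).length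
    (by intro j; fin_cases j <;> simp [hl])
  -- the longer representation sticks out by `w₀`, where the first track is zero
  obtain ⟨w₀, w₁, rfl, hw₁⟩ : ∃ w₀ w₁, w = w₀ ++ w₁ ∧ w₁.length = (S.rep n).length :=
    ⟨w.take ((S.rep i).length - (S.rep n).length), w.drop ((S.rep i).length - (S.rep n).length),
      (List.take_append_drop _ _).symm, by rw [List.length_drop]; omega⟩
  have ht : track 0 w₀ ++ track 0 w₁ =
      List.replicate w₀.length 0 ++ S.rep n := by
    have := hr.track_eq 0
    rw [track_append] at this
    rw [this]
    simp only [List.leftpad, Matrix.cons_val_zero, List.length_append, hw₁, Nat.add_sub_cancel]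
  obtain ⟨ht0, ht1⟩ := List.append_inj ht (by simp)
  obtain ⟨w', hsub, hl', he⟩ := exists_short_sublist
    (A.inter (V.comap fun d : Fin 2 → Fin b => d 1)) (A.inter (V.comap fun d => d 1)).start w₀
  have hacc : ∀ w : List (Fin 2 → Fin b),
      w ∈ (A.inter (V.comap fun d : Fin 2 → Fin b => d 1)).accepts ↔
        w ∈ A.accepts ∧ ∃ m, strip (track 1 w) = S.rep m := by
    intro w
    rw [DFA.accepts_inter, DFA.accepts_comap]
    refine and_congr Iff.rfl ((hV _).trans ?_)
    simp [track, Function.comp_def]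
  have h1 : w' ++ w₁ ∈ (A.inter (V.comap fun d : Fin 2 → Fin b => d 1)).accepts := by
    rw [DFA.mem_accepts, DFA.eval, DFA.evalFrom_of_append, he, ← DFA.evalFrom_of_append]
    exact (hacc _).2 ⟨(hA _ _ hr).2 h, i, hr 1⟩
  obtain ⟨h2, m, hm⟩ := (hacc _).1 h1
  have hr' : S.Represents (w' ++ w₁) ![n, m] := by
    intro j
    fin_cases j
    · have h0 : ∀ d ∈ w', (d 0 : ℕ) = 0 := by
        intro d hd
        have : (d 0 : ℕ) ∈ track 0 w₀ := List.mem_map.2 ⟨d, hsub.subset hd, rfl⟩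
        rw [ht0] at this
        exact List.eq_of_mem_replicate this
      change strip (track 0 (w' ++ w₁)) = S.rep n
      rw [track_append, track_eq_replicate h0, strip_replicate_append, ht1, strip_rep]
    · exact hm
  refine ⟨m, (hA _ _ hr').1 h2, (hr'.length_rep_le 1).trans ?_⟩
  rw [Fintype.card_prod] at hl'
  have := Nat.mul_le_mul hcA hcV
  rw [List.length_append]
  omega

/-- A DFA that decides a recognized relation on short representations decides it on all. -/
theorem IsRec.forall_of_small {R : ℕ → Prop} {s m : ℕ} (hV : S.HasValid b sA)
    (hs : S.IsRec b {v : Fin 1 → ℕ | R (v 0)} s) (N : DFA (Fin b) (Fin m))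
    (hN : ∀ (w : List (Fin b)) n, w.map Fin.val = S.rep n → w.length ≤ 1 + m * (s * sA) →
      (w ∈ N.accepts ↔ R n)) (w : List (Fin b)) (n : ℕ) (hw : w.map Fin.val = S.rep n) :
    w ∈ N.accepts ↔ R n := by
  obtain ⟨hb, τ, _, V, hcV, hV⟩ := hV
  obtain ⟨σ, _, A, hcA, hA⟩ := hs
  cases w with
  | nil => exact hN _ _ hw (by simp)
  | cons d w =>
    -- the first letter is kept, so that the shortened word does not start with `0` either
    let A' : DFA (Fin b) σ := A.comap fun d _ => d
    let B := N.inter (A'.inter V)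
    obtain ⟨w', -, hl, he⟩ := exists_short_sublist B (B.step B.start d) w
    have hA' : ∀ w n, strip (w.map Fin.val) = S.rep n → (w ∈ A'.accepts ↔ R n) := by
      intro w n hw
      rw [DFA.accepts_comap]
      exact hA _ _ (represents_single.2 hw)
    have he' : B.eval (d :: w') = B.eval (d :: w) := he
    have hB : ∀ w, B.eval w = (N.eval w, A'.eval w, V.eval w) := by
      intro w
      induction w using List.reverseRecOn with
      | nil => rfl
      | append_singleton w d ih => simp only [DFA.eval_append_singleton, ih]; rfl
    rw [hB, hB, Prod.mk.injEq, Prod.mk.injEq] at he'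
    obtain ⟨e1, e2, e3⟩ := he'
    have hd : strip ((d :: w).map Fin.val) = S.rep n := by rw [hw, strip_rep]
    have hV' : d :: w' ∈ V.accepts := by
      rw [DFA.mem_accepts, e3]
      exact (hV _).2 ⟨n, hd⟩
    obtain ⟨n', hn'⟩ := (hV _).1 hV'
    have hd' : (d :: w').map Fin.val = S.rep n' := by
      rw [← hn', strip_of_head?_ne]
      have := S.head?_rep_ne n
      rw [← hw] at this
      simpa using this
    have h1 := hN _ _ hd' (by
      simp only [Fintype.card_prod, Fintype.card_fin] at hl
      have := Nat.mul_le_mul (le_refl m) (Nat.mul_le_mul hcA hcV)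
      rw [List.length_cons]
      omega)
    rw [← hA' _ _ hn', DFA.mem_accepts, DFA.mem_accepts, e1, e2] at h1
    rw [← hA' _ _ hd]
    exact h1

end NumSys


/-! ### Counting the classes -/

section Counting

variable {x : ℕ → ℕ}

theorem length_factor (x : ℕ → ℕ) (i n : ℕ) : (factor x i n).length = n := by simp [factor]

theorem additiveComplexity_eq_ncard_range (x : ℕ → ℕ) (n : ℕ) :
    additiveComplexity x n = (Set.range fun i => (factor x i n).sum).ncard := by
  have h : Set.range (fun i => (factor x i n).sum) =
      (Quotient.lift (s := additiveSetoid) List.sum fun _ _ h => h.2) ''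
        (Quotient.mk additiveSetoid '' factors x n) := by
    rw [factors, ← Set.range_comp, ← Set.range_comp]
    rfl
  rw [h, Set.InjOn.ncard_image]
  · rfl
  · rintro _ ⟨_, ⟨i, rfl⟩, rfl⟩ _ ⟨_, ⟨i', rfl⟩, rfl⟩ h
    exact Quotient.sound ⟨(length_factor x i n).trans (length_factor x i' n).symm, h⟩

theorem image_isNew (x : ℕ → ℕ) (n : ℕ) :
    (fun i => (factor x i n).sum) '' {i | IsNew x n i} = Set.range fun i => (factor x i n).sum := by
  classical
  refine Set.Subset.antisymm (Set.image_subset_range _ _) ?_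
  rintro _ ⟨i, rfl⟩
  have hex : ∃ i', (factor x i' n).sum = (factor x i n).sum := ⟨i, rfl⟩
  refine ⟨Nat.find hex, fun i' hi' h => Nat.find_min hex hi' ?_, Nat.find_spec hex⟩
  exact h.trans (Nat.find_spec hex)

theorem injOn_isNew (x : ℕ → ℕ) (n : ℕ) :
    Set.InjOn (fun i => (factor x i n).sum) {i | IsNew x n i} := by
  intro i hi i' hi' h
  rcases lt_trichotomy i i' with hlt | rfl | hlt
  · exact absurd h (hi' i hlt)
  · rfl
  · exact absurd h.symm (hi i' hlt)

theorem additiveComplexity_eq_ncard_isNew (x : ℕ → ℕ) (n : ℕ) :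
    additiveComplexity x n = {i | IsNew x n i}.ncard := by
  rw [additiveComplexity_eq_ncard_range, ← image_isNew, (injOn_isNew x n).ncard_image]

theorem finite_isNew {B : ℕ} (hx : ∀ i, x i ≤ B) (n : ℕ) : {i | IsNew x n i}.Finite := by
  refine Set.Finite.of_finite_image ?_ (injOn_isNew x n)
  refine (Set.finite_Iic (n * B)).subset ?_
  rintro _ ⟨i, -, rfl⟩
  have : (factor x i n).sum ≤ (factor x i n).length • B :=
    List.sum_le_card_nsmul _ _ fun y hy => by
      obtain ⟨j, -, rfl⟩ := List.mem_map.1 hy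
      exact hx _
  rwa [length_factor] at this

open Classical in
theorem count_isNew_le {B : ℕ} (hx : ∀ i, x i ≤ B) (n K : ℕ) :
    Nat.count (IsNew x n) K ≤ additiveComplexity x n := by
  rw [additiveComplexity_eq_ncard_isNew, Nat.count_eq_card_filter_range, ← Set.ncard_coe_finset]
  exact Set.ncard_le_ncard (fun i hi => by simpa using (Finset.mem_filter.1 hi).2)
    (finite_isNew hx n)

open Classical in
theorem exists_forall_count_isNew_eq {B : ℕ} (hx : ∀ i, x i ≤ B) (n : ℕ) :
    ∃ K, ∀ K' ≥ K, Nat.count (IsNew x n) K' = additiveComplexity x n := by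
  obtain ⟨K, hK⟩ := (finite_isNew hx n).bddAbove
  refine ⟨K + 1, fun K' h => ?_⟩
  rw [additiveComplexity_eq_ncard_isNew, Nat.count_eq_card_filter_range, ← Set.ncard_coe_finset]
  congr 1
  ext i
  simp only [Finset.coe_filter, Finset.mem_range, Set.mem_ofPred_eq, and_iff_right_iff_imp]
  intro hi
  have := hK hi
  omega

open Classical in
/-- `NewAfter`, which is defined by recursion in order to be recognizable, in terms of counting. -/
theorem newAfter_iff (x : ℕ → ℕ) (n j i : ℕ) :
    NewAfter x n j i ↔ IsNew x n i ∧ j ≤ Nat.count (IsNew x n) i := by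
  induction j generalizing i with
  | zero => simp [NewAfter]
  | succ j ih =>
    simp only [NewAfter, ih]
    refine and_congr Iff.rfl ⟨?_, fun h => ?_⟩
    · rintro ⟨i', hlt, hi', h⟩
      exact lt_of_le_of_lt h (Nat.count_strict_mono hi' hlt)
    · induction i with
      | zero => simp at h
      | succ i ih' =>
        by_cases hi : IsNew x n i
        · rw [Nat.count_succ, if_pos hi] at h
          exact ⟨i, Nat.lt_succ_self i, hi, by omega⟩
        · rw [Nat.count_succ, if_neg hi] at h
          obtain ⟨i', h1, h2⟩ := ih' h
          exact ⟨i', by omega, h2⟩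

open Classical in
theorem lt_count_isNew_iff (x : ℕ → ℕ) (n j K : ℕ) :
    j < Nat.count (IsNew x n) K ↔ ∃ i < K, NewAfter x n j i := by
  constructor
  · intro h
    induction K with
    | zero => simp at h
    | succ K ih =>
      by_cases hK : IsNew x n K
      · rw [Nat.count_succ, if_pos hK] at h
        exact ⟨K, Nat.lt_succ_self K, (newAfter_iff x n j K).2 ⟨hK, by omega⟩⟩
      · rw [Nat.count_succ, if_neg hK] at h
        obtain ⟨i, h1, h2⟩ := ih h
        exact ⟨i, by omega, h2⟩
  · rintro ⟨i, hi, h⟩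
    obtain ⟨h1, h2⟩ := (newAfter_iff x n j i).1 h
    exact lt_of_le_of_lt h2 (Nat.count_strict_mono h1 hi)

theorem exists_newAfter_iff {B : ℕ} (hx : ∀ i, x i ≤ B) (n j : ℕ) :
    (∃ i, NewAfter x n j i) ↔ j < additiveComplexity x n := by
  classical
  constructor
  · rintro ⟨i, hi⟩
    exact ((lt_count_isNew_iff x n j (i + 1)).2 ⟨i, Nat.lt_succ_self i, hi⟩).trans_le
      (count_isNew_le hx n _)
  · intro h
    obtain ⟨K, hK⟩ := exists_forall_count_isNew_eq hx n
    rw [← hK K le_rfl] at h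
    obtain ⟨i, -, hi⟩ := (lt_count_isNew_iff x n j K).1 h
    exact ⟨i, hi⟩

/-- The sum of a word as a sum of components of its Parikh vector, the component of the letter `a i`
being repeated `a i` times. -/
theorem sum_eq_sum_parikh {k : ℕ} {a : Fin k → ℕ} (ha : StrictMono a) (w : List ℕ)
    (hw : ∀ y ∈ w, ∃ i, y = a i) :
    w.sum = (((List.finRange k).flatMap fun i => List.replicate (a i) i).map (parikh a w)).sum := by
  have h : (((List.finRange k).flatMap fun i => List.replicate (a i) i).map (parikh a w)).sum =
      ∑ i, a i * parikh a w i := by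
    rw [← List.sum_ofFn, List.ofFn_eq_map]
    induction List.finRange k with
    | nil => rfl
    | cons i l ih =>
      rw [List.flatMap_cons, List.map_append, List.sum_append, ih]
      simp
  rw [h]
  clear h
  induction w with
  | nil => simp [parikh]
  | cons y w ih =>
    obtain ⟨i, rfl⟩ := hw y (by simp)
    have : ∀ i', a i' * parikh a (a i :: w) i' =
        a i' * parikh a w i' + if i' = i then a i' else 0 := by
      intro i'
      by_cases h : i' = i
      · subst h; simp [parikh]; ring
      · have h' : a i ≠ a i' := fun he => h (ha.injective he).symm
        simp [parikh, List.count_cons_of_ne h', h]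
    simp only [this]
    rw [Finset.sum_add_distrib, List.sum_cons, ih fun y hy => hw y (by simp [hy])]
    simp [add_comm]

end Counting


/-! ### Computing additive complexity by an automaton -/

/-- Number of states for `NewAfter x · j ·`, where the alphabet of `x` consists of `k` letters with
sum `r`, and addition and the Parikh vectors of prefixes are recognized with
`sA` and `sP` states. -/
def stateBound (sA sP k r j : ℕ) : ℕ := afterBound sA (newBound sA (sumBound sA sP k r)) j

/-- Representations up to this length suffice to compare a DFAO with `m` states with additive
complexity. -/
def testBound (sA m E : ℕ) : ℕ := 1 + m * (2 ^ (E * sA) * sA)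

theorem stateBound_mono {sA : ℕ} (hA : 0 < sA) (sP k r : ℕ) : Monotone (stateBound sA sP k r) := by
  refine monotone_nat_of_le_succ fun j => ?_
  have h1 : 0 < newBound sA (sumBound sA sP k r) := Nat.pow_pos two_pos
  change _ ≤ newBound sA (sumBound sA sP k r) * 2 ^ (stateBound sA sP k r j * (sA * sA) * sA ^ 2)
  calc stateBound sA sP k r j ≤ 2 ^ stateBound sA sP k r j := Nat.lt_two_pow_self.le
    _ ≤ 2 ^ (stateBound sA sP k r j * (sA * sA) * sA ^ 2) := by
        refine Nat.pow_le_pow_right two_pos ?_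
        rw [mul_assoc]
        exact Nat.le_mul_of_pos_right _ (by positivity)
    _ ≤ _ := Nat.le_mul_of_pos_left _ h1

namespace NumSys

variable {S : NumSys} {b sA sP : ℕ}

theorem lt_of_length_rep_lt {m n : ℕ} (h : (S.rep m).length < (S.rep n).length) : m < n := by
  by_contra hle
  exact absurd (S.length_rep_mono (not_lt.1 hle)) (not_le.2 h)

theorem isRec_newAfter_of_parikh [NeZero b] {k : ℕ} {a : Fin k → ℕ} {x : ℕ → ℕ} (ha : StrictMono a)
    (hx : ∀ n, ∃ i, x n = a i) (hA : S.IsRec b additionGraph sA) (hV : S.HasValid b sA)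
    (hP : S.IsRec b (vectorGraph (prefixParikh a x)) sP) (j : ℕ) :
    S.IsRec b {v : Fin 2 → ℕ | NewAfter x (v 0) j (v 1)}
      (stateBound sA sP k (List.ofFn a).sum j) := by
  refine isRec_newAfter hA hV (isRec_isNew hA hV ?_) j
  refine (isRec_sum hA hV hP ((List.finRange k).flatMap fun i => List.replicate (a i) i)).congr
    (fun v => ?_) (le_of_eq ?_)
  · simp only [Set.mem_ofPred_eq]
    rw [sum_eq_sum_parikh ha]
    · rfl
    · intro y hy
      obtain ⟨j, -, rfl⟩ := List.mem_map.1 hy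
      exact hx _
  · rw [List.length_flatMap, List.ofFn_eq_map]
    simp

/-- When additive complexity is bounded, a product of automata for the relations
`j < additiveComplexity x n` computes it. -/
theorem exists_dfao [NeZero b] {k : ℕ} {a : Fin k → ℕ} {x : ℕ → ℕ} (ha : StrictMono a)
    (hx : ∀ n, ∃ i, x n = a i) (hA : S.IsRec b additionGraph sA) (hV : S.HasValid b sA)
    (hP : S.IsRec b (vectorGraph (prefixParikh a x)) sP)
    (hC : ∃ C, ∀ n, additiveComplexity x n ≤ C) :
    ∃ (s : ℕ) (N : DFAO (Fin b) (Fin s) ℕ), ∀ (w : List (Fin b)) n,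
      w.map Fin.val = S.rep n → N.run w = additiveComplexity x n := by
  classical
  obtain ⟨C, hC⟩ := hC
  have hB : ∀ i, x i ≤ ∑ i, a i := fun i => by
    obtain ⟨j, hj⟩ := hx i
    rw [hj]
    exact Finset.single_le_sum (fun _ _ => Nat.zero_le _) (Finset.mem_univ j)
  have h : ∀ j : Fin C, _ := fun j => isRec_exists (R := fun n i => NewAfter x n j i) hV
    (isRec_newAfter_of_parikh ha hx hA hV hP j)
  choose σ hσ A _ hA' using h
  let e := Fintype.equivFin ((j : Fin C) → σ j)
  let N : DFAO (Fin b) (Fin (Fintype.card ((j : Fin C) → σ j))) ℕ :=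
    { step := fun q d => e fun j => (A j).step (e.symm q j) fun _ => d
      start := e fun j => (A j).start
      out := fun q => (Finset.univ.filter fun j => e.symm q j ∈ (A j).accept).card }
  refine ⟨_, N, fun w n hw => ?_⟩
  have hN : ∀ w : List (Fin b), w.foldl N.step N.start =
      e fun j => (A j).eval (w.map fun d => fun _ => d) := by
    intro w
    induction w using List.reverseRecOn with
    | nil => rfl
    | append_singleton w d ih =>
      rw [List.foldl_append, ih]
      simp [N]
  have hacc : ∀ j : Fin C, (A j).eval (w.map fun d => fun _ => d) ∈ (A j).accept ↔
      (j : ℕ) < additiveComplexity x n := fun j => by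
    rw [← DFA.mem_accepts, hA' j _ (fun _ => n)
      (represents_single.2 (by rw [hw, strip_rep])), ← exists_newAfter_iff hB]
    rfl
  have hout : N.run w = (Finset.univ.filter fun j : Fin C =>
      (j : ℕ) < additiveComplexity x n).card := by
    unfold DFAO.run
    rw [hN]
    simp only [N, Equiv.symm_apply_apply, hacc]
  rw [hout, Fin.card_filter_val_lt, min_eq_right (hC n)]

open Classical in
/-- A DFAO computes additive complexity if, for all `n` with a short representation, its output is
the number of new positions less than `K₂`. For each `j ≤ C`, the position `K₂` is so large that the
count decides `j < additiveComplexity x n` for these `n`, and they are so many that a DFA deciding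
`j < additiveComplexity x n` for them does so for all `n`. -/
theorem run_eq_of_small [NeZero b] {k : ℕ} {a : Fin k → ℕ} {x : ℕ → ℕ} (ha : StrictMono a)
    (hx : ∀ n, ∃ i, x n = a i) (hA : S.IsRec b additionGraph sA) (hV : S.HasValid b sA)
    (hP : S.IsRec b (vectorGraph (prefixParikh a x)) sP) (hA0 : 0 < sA) {m : ℕ}
    (N : DFAO (Fin b) (Fin m) ℕ) {C E K₁ K₂ : ℕ} (hC : ∀ q, N.out q ≤ C)
    (hE : E = stateBound sA sP k (List.ofFn a).sum C)
    (h₁ : testBound sA m E < (S.rep K₁).length)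
    (h₂ : testBound sA m E + E * sA < (S.rep K₂).length)
    (h : ∀ n < K₁, ∀ w : List (Fin b), w.map Fin.val = S.rep n →
      N.run w = Nat.count (IsNew x n) K₂)
    (w : List (Fin b)) (n : ℕ) (hw : w.map Fin.val = S.rep n) :
    N.run w = additiveComplexity x n := by
  have hB : ∀ i, x i ≤ ∑ i, a i := fun i => by
    obtain ⟨j, hj⟩ := hx i
    rw [hj]
    exact Finset.single_le_sum (fun _ _ => Nat.zero_le _) (Finset.mem_univ j)
  have key : ∀ j ≤ C, (j < N.run w ↔ j < additiveComplexity x n) := by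
    intro j hj
    have hR := (isRec_newAfter_of_parikh ha hx hA hV hP j).congr (fun _ => Iff.rfl)
      (stateBound_mono hA0 sP k _ hj)
    rw [← hE] at hR
    rw [← exists_newAfter_iff hB]
    refine (isRec_exists (R := fun n i => NewAfter x n j i) hV hR).forall_of_small
      (R := fun n => ∃ i, NewAfter x n j i) hV
      ⟨N.step, N.start, {q | j < N.out q}⟩ (fun w n hw hl => ?_) w n hw
    have hl' : (S.rep n).length ≤ testBound sA m E := by
      rw [← hw, List.length_map]
      exact hl
    change j < N.run w ↔ _
    rw [h n (lt_of_length_rep_lt (hl'.trans_lt h₁)) w hw, lt_count_isNew_iff]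
    constructor
    · rintro ⟨i, -, hi⟩
      exact ⟨i, hi⟩
    · rintro ⟨i, hi⟩
      obtain ⟨i', hi', hl''⟩ := hR.exists_small (R := fun n i => NewAfter x n j i) hV hi
      exact ⟨i', lt_of_length_rep_lt (S := S) (by omega), hi'⟩
  -- both numbers are compared with `j = additiveComplexity x n` and `j = N.run w`
  have hle : N.run w ≤ C := hC _
  refine le_antisymm (not_lt.1 fun hlt => ?_) (not_lt.1 fun hlt => ?_)
  · exact lt_irrefl _ ((key _ (by omega)).1 hlt)
  · exact lt_irrefl _ ((key _ hle).2 hlt)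

end NumSys

/-! ### Tables of automata -/

/-- The number of states of an automaton given by its table. -/
def Table.states (t : Table) : ℕ := t.2.2.length

/-- The output of an automaton given by its table, on a word over the numbers of its letters. -/
def runTable (t : Table) (w : List ℕ) : ℕ :=
  t.2.2.getD (w.foldl (fun q l => (t.2.1.getD q []).getD l 0) t.1) 0

/-- The table `t` describes a DFAO over the digits `0, …, b - 1`. -/
def Table.WellFormed (b : ℕ) (t : Table) : Prop :=
  t.1 < t.states ∧ t.2.1.length = t.states ∧ ∀ r ∈ t.2.1, r.length = b ∧ ∀ q ∈ r, q < t.states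

theorem states_table {α : Type} {c s : ℕ} (e : Fin c ≃ α) (M : DFAO α (Fin s) ℕ) :
    (M.table e).states = s := by
  simp [Table.states, DFAO.table]

theorem runTable_table {α : Type} {c s : ℕ} (e : Fin c ≃ α) (M : DFAO α (Fin s) ℕ) (w : List α) :
    runTable (M.table e) (w.map fun d => (e.symm d : ℕ)) = M.run w := by
  have h : ∀ (w : List α) (q : Fin s), (w.map fun d => (e.symm d : ℕ)).foldl
      (fun q l => ((M.table e).2.1.getD q []).getD l 0) (q : ℕ) = (w.foldl M.step q : Fin s) := by
    intro w
    induction w with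
    | nil => intro q; rfl
    | cons d w ih =>
      intro q
      rw [List.map_cons, List.foldl_cons, List.foldl_cons, ← ih]
      congr 1
      simp [DFAO.table]
  unfold runTable
  change List.getD (List.ofFn M.out) (List.foldl _ (M.start : ℕ) _) 0 = _
  rw [h]
  simp [DFAO.run]

theorem states_digitTable {b s : ℕ} (M : DFAO (Fin b) (Fin s) ℕ) : (digitTable M).states = s :=
  states_table _ M

theorem states_tupleTable {m b s : ℕ} (A : DFA (Fin m → Fin b) (Fin s)) :
    (tupleTable A).states = s := states_table _ _

theorem wellFormed_digitTable {b s : ℕ} (M : DFAO (Fin b) (Fin s) ℕ) :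
    (digitTable M).WellFormed b := by
  unfold Table.WellFormed
  rw [states_digitTable]
  refine ⟨M.start.2, by simp [digitTable, DFAO.table], fun r hr => ?_⟩
  obtain ⟨q, rfl⟩ := List.mem_ofFn.1 hr
  refine ⟨by simp, fun q' hq' => ?_⟩
  obtain ⟨l, rfl⟩ := List.mem_ofFn.1 hq'
  exact Fin.is_lt _

theorem Table.WellFormed.exists_dfao {b : ℕ} {t : Table} (h : t.WellFormed b) :
    ∃ (s : ℕ) (N : DFAO (Fin b) (Fin s) ℕ), digitTable N = t := by
  obtain ⟨h1, h2, h3⟩ := h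
  refine ⟨t.states, ⟨fun q l => ⟨(t.2.1[q]'(by omega))[l]'(
    lt_of_lt_of_eq l.2 (h3 _ (List.getElem_mem _)).1.symm),
    (h3 _ (List.getElem_mem _)).2 _ (List.getElem_mem _)⟩, ⟨t.1, h1⟩, fun q => t.2.2[q]'q.2⟩, ?_⟩
  obtain ⟨t₀, t₁, t₂⟩ := t
  simp only [digitTable, DFAO.table, Prod.mk.injEq, true_and]
  constructor
  · refine List.ext_getElem (by simp [h2]) fun q hq hq' => ?_
    refine List.ext_getElem (by simp [(h3 _ (List.getElem_mem hq')).1]) fun l hl hl' => ?_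
    simp
  · refine List.ext_getElem (by simp [Table.states]) fun q hq hq' => ?_
    simp
    rfl

/-- The letter at position `p` of the word `w` padded with leading zeros to length `L`. -/
def paddedDigit (L : ℕ) (w : List ℕ) (p : ℕ) : ℕ :=
  if p + w.length < L then 0 else w.getD (p + w.length - L) 0

theorem map_paddedDigit {L : ℕ} {w : List ℕ} (h : w.length ≤ L) :
    (List.range L).map (paddedDigit L w) = List.leftpad L 0 w := by
  refine List.ext_getElem (by simp [h]) fun p hp hp' => ?_
  simp only [List.length_map, List.length_range] at hp
  simp only [List.getElem_map, List.getElem_range, paddedDigit, List.leftpad, List.getElem_append,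
    List.length_replicate, List.getElem_replicate]
  split_ifs with h1 h2 h2
  · rfl
  · omega
  · omega
  · rw [List.getD_eq_getElem _ _ (by omega)]
    congr 1
    omega

/-- The word that a DFA for addition reads in order to check `u + 1 = v`, for words `u` and `v` of
digits less than `b`, with letters numbered as in `tupleTable`. -/
def succWord (b : ℕ) (u v : List ℕ) : List ℕ :=
  (List.range v.length).map fun p => paddedDigit v.length u p + paddedDigit v.length [1] p * b +
    paddedDigit v.length v p * (b * b)

/-- The automaton with the table `t` accepts `u + 1 = v`, where `v` is a word of digits less than
`b` that is neither empty nor shorter than `u` and does not start with `0`. -/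
def IsSuccWord (b : ℕ) (t : Table) (u v : List ℕ) : Prop :=
  u.length ≤ v.length ∧ v.headI ≠ 0 ∧ (∀ d ∈ v, d < b) ∧ runTable t (succWord b u v) = 1

theorem runTable_tupleTable {m b s : ℕ} (A : DFA (Fin m → Fin b) (Fin s))
    (w : List (Fin m → Fin b)) :
    runTable (tupleTable A) (w.map fun d => (finFunctionFinEquiv d : ℕ)) = 1 ↔ w ∈ A.accepts := by
  classical
  have := runTable_table (finFunctionFinEquiv (m := b) (n := m)).symm
    (⟨A.step, A.start, fun q => if q ∈ A.accept then 1 else 0⟩ : DFAO (Fin m → Fin b) (Fin s) ℕ) w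
  rw [Equiv.symm_symm] at this
  unfold tupleTable
  rw [this]
  unfold DFAO.run
  rw [ite_eq_left_iff]
  simp
  rfl

/-- `succWord b u v` is the word of letter numbers of the triple `u, 1, v` in parallel. -/
theorem exists_succWord_eq {b : ℕ} {u v : List ℕ} (h1 : 1 < b) (hl : u.length ≤ v.length)
    (hv0 : 0 < v.length) (hu : ∀ d ∈ u, d < b) (hv : ∀ d ∈ v, d < b) :
    ∃ w : List (Fin 3 → Fin b), w.length = v.length ∧
      (∀ i, track i w = List.leftpad v.length 0 ((![u, [1], v] : Fin 3 → List ℕ) i)) ∧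
      w.map (fun d => (finFunctionFinEquiv d : ℕ)) = succWord b u v := by
  have hlen : ∀ i, ((![u, [1], v] : Fin 3 → List ℕ) i).length ≤ v.length := by
    intro i; fin_cases i <;> simp <;> omega
  obtain ⟨w, hw, ht⟩ := exists_tracks (b := b) v.length
    (fun i => List.leftpad v.length 0 ((![u, [1], v] : Fin 3 → List ℕ) i))
    (fun i => by simp [hlen i]) (fun i d hd => by
      rw [List.leftpad, List.mem_append] at hd
      rcases hd with hd | hd
      · rw [List.eq_of_mem_replicate hd]; omega
      · fin_cases i
        · exact hu d hd
        · obtain rfl : d = 1 := by simpa using hd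
          exact h1
        · exact hv d hd)
  refine ⟨w, hw, ht, ?_⟩
  have hdig : ∀ (i : Fin 3) (p : ℕ) (hp : p < w.length),
      ((w[p] i : Fin b) : ℕ) = paddedDigit v.length ((![u, [1], v] : Fin 3 → List ℕ) i) p := by
    intro i p hp
    have := congrArg (fun l => l[p]?) (ht i)
    rw [← map_paddedDigit (hlen i)] at this
    simpa [track, hp, show p < v.length by omega] using this
  refine List.ext_getElem (by simp [succWord, hw]) fun p hp hp' => ?_
  have hp1 : p < w.length := by simpa using hp
  simp only [List.getElem_map, succWord, List.getElem_range, finFunctionFinEquiv_apply,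
    Fin.sum_univ_three, hdig _ p hp1]
  simp [pow_two]

namespace NumSys

variable {S : NumSys} {b s : ℕ} {A : DFA (Fin 3 → Fin b) (Fin s)}

theorem Recognizes.one_lt (h : S.Recognizes A additionGraph) : 1 < b := by
  have := h.digit_lt (v := ![1, 0, 1]) (by simp [additionGraph]) 0 1
  simpa [rep_one] using this

theorem Recognizes.rep_lt (h : S.Recognizes A additionGraph) (n : ℕ) : ∀ d ∈ S.rep n, d < b :=
  h.digit_lt (v := ![n, 0, n]) (by simp [additionGraph]) 0

theorem headI_rep_succ_ne (S : NumSys) (n : ℕ) : (S.rep (n + 1)).headI ≠ 0 := by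
  have h := S.head?_rep_ne (n + 1)
  rcases hr : S.rep (n + 1) with _ | ⟨d, l⟩
  · have := S.rep_injective (hr.trans S.rep_zero.symm)
    omega
  · rw [hr] at h
    simpa using h

/-- The automaton for addition determines the representation of `n + 1` from that of `n`. -/
theorem Recognizes.isSuccWord_iff (h : S.Recognizes A additionGraph) (n : ℕ) (v : List ℕ) :
    IsSuccWord b (tupleTable A) (S.rep n) v ↔ v = S.rep (n + 1) := by
  constructor
  · rintro ⟨h1, h2, h3, h4⟩
    have hv0 : 0 < v.length := by
      cases v
      · simp at h2
      · simp
    obtain ⟨w, -, ht, hs⟩ := exists_succWord_eq h.one_lt h1 hv0 (h.rep_lt n) h3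
    rw [← hs, runTable_tupleTable] at h4
    obtain ⟨z, hz, hp⟩ := h.2 w h4
    have hr : ∀ i, strip ((![S.rep n, [1], v] : Fin 3 → List ℕ) i) = S.rep (z i) := fun i => by
      rw [← hp.represents i, ht, strip_leftpad]
    have e0 : n = z 0 := S.rep_injective (by simpa using hr 0)
    have e1 : 1 = z 1 := S.rep_injective (by rw [← hr 1]; simp [rep_one, strip])
    have e2 : strip v = S.rep (z 2) := hr 2
    rw [strip_of_head?_ne] at e2
    · rw [e2, e0, e1]
      exact congrArg S.rep hz.symm
    · cases v <;> simp at h2 ⊢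
      exact h2
  · rintro rfl
    have hl : (S.rep n).length ≤ (S.rep (n + 1)).length := S.length_rep_mono (Nat.le_succ n)
    have hv0 : 0 < (S.rep (n + 1)).length := by
      have := S.headI_rep_succ_ne n
      cases hr : S.rep (n + 1)
      · simp [hr] at this
      · simp
    refine ⟨hl, S.headI_rep_succ_ne n, h.rep_lt _, ?_⟩
    obtain ⟨w, hw, ht, hs⟩ := exists_succWord_eq h.one_lt hl hv0 (h.rep_lt n) (h.rep_lt _)
    rw [← hs, runTable_tupleTable]
    have hr : S.Represents w ![n, 1, n + 1] := fun i => by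
      rw [ht, strip_leftpad]
      fin_cases i
      · exact S.strip_rep n
      · simp [rep_one, strip]
      · exact S.strip_rep (n + 1)
    obtain ⟨w', hw', hp⟩ := h.1 ![n, 1, n + 1] (by simp [additionGraph])
    have hle := hr.length_le hp.represents hp.head
    have hge := hp.represents.length_rep_le 2
    have hlen : w'.length = w.length := by
      simp only [Matrix.cons_val] at hge
      omega
    have : w' = w := track_ext hlen fun i => by rw [hp.represents.track_eq, hr.track_eq, hlen]
    rwa [← this]

end NumSys


/-! ### Certificates -/

/-- The sum of the factor of length `n` at `i`, when the `j`-th letter is the output of the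
automaton with the table `t` on the `j`-th word of `W`. -/
def tableSum (t : Table) (W : List (List ℕ)) (n i : ℕ) : ℕ :=
  ((List.range n).map fun j => runTable t (W.getD (i + j) [])).foldr (· + ·) 0

/-- The number of distinct values of `tableSum t W n i` for `i < K`. -/
def tableCount (t : Table) (W : List (List ℕ)) (K n : ℕ) : ℕ :=
  ((List.range K).filter fun i => ∀ i' < i, tableSum t W n i' ≠ tableSum t W n i).length

/-- The number of states in `stateBound` for given data, when additive complexity is at most `C`. -/
def inputBound (I : ℕ × List ℕ × Table × Table × Table) (C : ℕ) : ℕ :=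
  stateBound (I.2.2.1.states + 1) (I.2.2.2.2.states + 1) I.2.1.length (I.2.1.foldr (· + ·) 0) C

/-- A certificate `(K₁, K₂, W, t)` for the table `t`, relative to the data `(b, a, tA, tM, tP)`: the
word `W i` represents `i` for all `i ≤ K₁ + K₂`, and `t` gives the number of sums of factors of
length `n` at positions less than `K₂` for all `n < K₁`, where `K₁` and `K₂` have sufficiently long
representations. -/
def Certifies (I : ℕ × List ℕ × Table × Table × Table) (c : ℕ × ℕ × List (List ℕ) × Table) :
    Prop :=
  c.2.2.2.WellFormed I.1 ∧
  c.2.2.1.getD 0 [] = [] ∧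
  (∀ i < c.1 + c.2.1, IsSuccWord I.1 I.2.2.1 (c.2.2.1.getD i []) (c.2.2.1.getD (i + 1) [])) ∧
  testBound (I.2.2.1.states + 1) c.2.2.2.states (inputBound I (c.2.2.2.2.2.foldr (· + ·) 0)) <
    (c.2.2.1.getD c.1 []).length ∧
  testBound (I.2.2.1.states + 1) c.2.2.2.states (inputBound I (c.2.2.2.2.2.foldr (· + ·) 0)) +
    inputBound I (c.2.2.2.2.2.foldr (· + ·) 0) * (I.2.2.1.states + 1) <
    (c.2.2.1.getD c.2.1 []).length ∧
  ∀ n < c.1, runTable c.2.2.2 (c.2.2.1.getD n []) = tableCount I.2.2.2.1 c.2.2.1 c.2.1 n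

namespace NumSys

variable {S : NumSys} {b s₁ s₂ : ℕ} {A : DFA (Fin 3 → Fin b) (Fin s₁)}

theorem computes_iff {M : DFAO (Fin b) (Fin s₂) ℕ} {y : ℕ → ℕ} :
    S.Computes M y ↔ ∀ n, ∃ w : List (Fin b), w.map Fin.val = S.rep n ∧ M.run w = y n := by
  unfold Computes
  simp [← List.map_eq_flatMap, Function.comp_def]

theorem Computes.runTable_rep {M : DFAO (Fin b) (Fin s₂) ℕ} {y : ℕ → ℕ} (h : S.Computes M y)
    (n : ℕ) : runTable (digitTable M) (S.rep n) = y n := by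
  obtain ⟨w, hw, hr⟩ := computes_iff.1 h n
  rw [← hw, ← hr]
  exact runTable_table (Equiv.refl (Fin b)) M w

theorem exists_map_val_eq (hb : ∀ n, ∀ d ∈ S.rep n, d < b) (n : ℕ) :
    ∃ w : List (Fin b), w.map Fin.val = S.rep n := by
  refine ⟨(S.rep n).pmap (fun d h => ⟨d, h⟩) (hb n), ?_⟩
  rw [List.map_pmap]
  simp

theorem computes_of_forall {N : DFAO (Fin b) (Fin s₂) ℕ} {y : ℕ → ℕ}
    (hb : ∀ n, ∀ d ∈ S.rep n, d < b)
    (h : ∀ (w : List (Fin b)) n, w.map Fin.val = S.rep n → N.run w = y n) : S.Computes N y := by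
  refine computes_iff.2 fun n => ?_
  obtain ⟨w, hw⟩ := S.exists_map_val_eq hb n
  exact ⟨w, hw, h w n hw⟩

theorem Recognizes.getD_eq_rep (h : S.Recognizes A additionGraph) {W : List (List ℕ)} {K : ℕ}
    (h0 : W.getD 0 [] = [])
    (hW : ∀ i < K, IsSuccWord b (tupleTable A) (W.getD i []) (W.getD (i + 1) [])) :
    ∀ i ≤ K, W.getD i [] = S.rep i := by
  intro i hi
  induction i with
  | zero => rw [h0, rep_zero]
  | succ i ih =>
    have := hW i (by omega)
    rw [ih (by omega)] at this
    exact (h.isSuccWord_iff i _).1 this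

open Classical in
theorem tableCount_eq {t : Table} {x : ℕ → ℕ} {W : List (List ℕ)} {K n : ℕ}
    (hW : ∀ i < K + n, runTable t (W.getD i []) = x i) :
    tableCount t W K n = Nat.count (IsNew x n) K := by
  have h : ∀ i < K, tableSum t W n i = (factor x i n).sum := by
    intro i hi
    unfold tableSum factor
    rw [List.sum]
    congr 1
    refine List.map_congr_left fun j hj => hW _ ?_
    rw [List.mem_range] at hj
    omega
  unfold tableCount
  rw [Nat.count, List.countP_eq_length_filter]
  congr 1
  refine List.filter_congr fun i hi => ?_
  rw [List.mem_range] at hi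
  refine decide_eq_decide.2 (forall₂_congr fun i' hi' => ?_)
  rw [h i hi, h i' (by omega)]

end NumSys

section Certificates

variable {S : NumSys} {k : ℕ} {a : Fin k → ℕ} {x : ℕ → ℕ} {b s₁ s₂ s₃ : ℕ}
  {A : DFA (Fin 3 → Fin b) (Fin s₁)} {M : DFAO (Fin b) (Fin s₂) ℕ}
  {P : DFA (Fin (k + 1) → Fin b) (Fin s₃)}

theorem inputBound_eq (C : ℕ) :
    inputBound (b, List.ofFn a, tupleTable A, digitTable M, tupleTable P) C =
      stateBound (s₁ + 1) (s₃ + 1) k (List.ofFn a).sum C := by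
  simp [inputBound, states_tupleTable, List.sum]

/-- Certified tables are correct. -/
theorem Certifies.computes (ha : StrictMono a) (hx : ∀ n, ∃ i, x n = a i)
    (hA : S.Recognizes A additionGraph) (hM : S.Computes M x)
    (hP : S.Recognizes P (vectorGraph (prefixParikh a x))) {c : ℕ × ℕ × List (List ℕ) × Table}
    (h : Certifies (b, List.ofFn a, tupleTable A, digitTable M, tupleTable P) c) :
    ∃ (s : ℕ) (N : DFAO (Fin b) (Fin s) ℕ), digitTable N = c.2.2.2 ∧
      S.Computes N (additiveComplexity x) := by
  classical
  obtain ⟨K₁, K₂, W, t⟩ := c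
  obtain ⟨h1, h2, h3, h4, h5, h6⟩ := h
  obtain ⟨s, N, rfl⟩ := h1.exists_dfao
  refine ⟨s, N, rfl, ?_⟩
  have : NeZero b := ⟨by have := hA.one_lt; omega⟩
  have hW := hA.getD_eq_rep h2 h3
  simp only at h4 h5 h6 hW
  rw [inputBound_eq, hW K₁ (by omega)] at h4
  rw [inputBound_eq, hW K₂ (by omega)] at h5
  rw [states_tupleTable, states_digitTable] at h4 h5
  refine NumSys.computes_of_forall hA.rep_lt (NumSys.run_eq_of_small ha hx hA.isRec hA.hasValid
    hP.isRec (Nat.succ_pos s₁) N (fun q => ?_) rfl h4 h5 fun n hn w hw => ?_)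
  -- the sum of all outputs of `N` is used as a bound for its outputs
  · exact List.single_le_sum (fun _ _ => Nat.zero_le _) _ (List.mem_ofFn.2 ⟨q, rfl⟩)
  · rw [← NumSys.tableCount_eq (t := digitTable M) (W := W), ← h6 n hn, hW n (by omega), ← hw]
    · exact (runTable_table (Equiv.refl (Fin b)) N w).symm
    · intro i hi
      rw [hW i (by omega), hM.runTable_rep]

theorem exists_certifies (ha : StrictMono a) (hx : ∀ n, ∃ i, x n = a i)
    (hA : S.Recognizes A additionGraph) (hM : S.Computes M x)
    (hC : ∃ C, ∀ n, additiveComplexity x n ≤ C)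
    (hP : S.Recognizes P (vectorGraph (prefixParikh a x))) :
    ∃ c, Certifies (b, List.ofFn a, tupleTable A, digitTable M, tupleTable P) c := by
  classical
  have : NeZero b := ⟨by have := hA.one_lt; omega⟩
  have hB : ∀ i, x i ≤ ∑ i, a i := fun i => by
    obtain ⟨j, hj⟩ := hx i
    rw [hj]
    exact Finset.single_le_sum (fun _ _ => Nat.zero_le _) (Finset.mem_univ j)
  obtain ⟨s, N, hN⟩ := NumSys.exists_dfao ha hx hA.isRec hA.hasValid hP.isRec hC
  have hNc := NumSys.computes_of_forall hA.rep_lt hN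
  obtain ⟨T, hT⟩ : ∃ T, T = testBound (s₁ + 1) (digitTable N).states
    (inputBound (b, List.ofFn a, tupleTable A, digitTable M, tupleTable P)
      ((digitTable N).2.2.foldr (· + ·) 0)) := ⟨_, rfl⟩
  obtain ⟨T', hT'⟩ : ∃ T', T' = T +
    inputBound (b, List.ofFn a, tupleTable A, digitTable M, tupleTable P)
      ((digitTable N).2.2.foldr (· + ·) 0) * (s₁ + 1) := ⟨_, rfl⟩
  choose f hf using exists_forall_count_isNew_eq hB
  -- `K₂` exceeds all positions at which a factor of length `n < S.U T` is new
  let K₂ := S.U T' + ∑ n ∈ Finset.range (S.U T), f n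
  have hW : ∀ i ≤ S.U T + K₂,
      ((List.range (S.U T + K₂ + 1)).map S.rep).getD i [] = S.rep i := by
    intro i hi
    rw [List.getD_eq_getElem _ _ (by simp; omega)]
    simp
  refine ⟨(S.U T, K₂, (List.range (S.U T + K₂ + 1)).map S.rep, digitTable N),
    wellFormed_digitTable N, ?_, fun i hi => ?_, ?_, ?_, fun n hn => ?_⟩
  · rw [hW 0 (by omega), S.rep_zero]
  · simp only at hi ⊢
    rw [hW i (by omega), hW (i + 1) (by omega)]
    exact (hA.isSuccWord_iff i _).2 rfl
  · simp only
    rw [states_tupleTable, ← hT, hW _ (by omega)]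
    exact S.lt_length_rep T
  · simp only
    rw [states_tupleTable, ← hT, ← hT', hW _ (by omega)]
    exact (S.lt_length_rep T').trans_le (S.length_rep_mono (Nat.le_add_right _ _))
  · simp only at hn ⊢
    rw [hW n (by omega), hNc.runTable_rep, NumSys.tableCount_eq (x := x)]
    · refine (hf n K₂ ?_).symm
      exact (Finset.single_le_sum (f := f) (fun _ _ => Nat.zero_le _)
        (Finset.mem_range.2 hn)).trans (Nat.le_add_left _ _)
    · intro i hi
      rw [hW i (by omega), hM.runTable_rep]

end Certificates


/-! ### Computability of the search -/

section Computability

variable {α : Type} [Primcodable α]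

theorem primrec_nat_pow : Primrec₂ ((· ^ ·) : ℕ → ℕ → ℕ) := Primrec₂.unpaired'.1 Nat.Primrec.pow

theorem primrecPred_forall_lt {p : α → ℕ → Prop} {f : α → ℕ} (hp : PrimrecRel p)
    (hf : Primrec f) : PrimrecPred fun a => ∀ i < f a, p a i :=
  ((hp.swap.forall_mem_list).comp (Primrec.list_range.comp hf) Primrec.id).of_eq fun a => by
    simp [Function.swap]

theorem primrec_sum {f : α → List ℕ} (hf : Primrec f) :
    Primrec fun a => (f a).foldr (· + ·) 0 :=
  Primrec.list_foldr (h := fun _ p => p.1 + p.2) hf (.const 0)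
    (Primrec.nat_add.comp (Primrec.fst.comp .snd) (Primrec.snd.comp .snd))

theorem primrec_sumBound {f g h l : α → ℕ} (hf : Primrec f) (hg : Primrec g) (hh : Primrec h)
    (hl : Primrec l) : Primrec fun a => sumBound (f a) (g a) (h a) (l a) := by
  have h1 {u : α → ℕ} (hu : Primrec u) : Primrec fun q : α × ℕ × ℕ => u q.1 := hu.comp .fst
  refine Primrec.nat_rec' hl hf (h := fun a q => 2 ^ (q.2 * (g a * f a) * f a ^ (h a + 1))) ?_
  exact primrec_nat_pow.comp (.const 2) (Primrec.nat_mul.comp (Primrec.nat_mul.comp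
    (Primrec.snd.comp .snd) (Primrec.nat_mul.comp (h1 hg) (h1 hf)))
    (primrec_nat_pow.comp (h1 hf) (Primrec.succ.comp (h1 hh))))

theorem primrec_newBound {f g : α → ℕ} (hf : Primrec f) (hg : Primrec g) :
    Primrec fun a => newBound (f a) (g a) :=
  primrec_nat_pow.comp (.const 2) (Primrec.nat_mul.comp (Primrec.nat_mul.comp
    (primrec_nat_pow.comp hf (.const 6)) (primrec_nat_pow.comp hg (.const 4)))
    (primrec_nat_pow.comp hf (.const 9)))

theorem primrec_afterBound {f g l : α → ℕ} (hf : Primrec f) (hg : Primrec g) (hl : Primrec l) :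
    Primrec fun a => afterBound (f a) (g a) (l a) := by
  have h1 {u : α → ℕ} (hu : Primrec u) : Primrec fun q : α × ℕ × ℕ => u q.1 := hu.comp .fst
  refine Primrec.nat_rec' hl hg (h := fun a q => g a * 2 ^ (q.2 * (f a * f a) * f a ^ 2)) ?_
  exact Primrec.nat_mul.comp (h1 hg) (primrec_nat_pow.comp (.const 2) (Primrec.nat_mul.comp
    (Primrec.nat_mul.comp (Primrec.snd.comp .snd) (Primrec.nat_mul.comp (h1 hf) (h1 hf)))
    (primrec_nat_pow.comp (h1 hf) (.const 2))))

theorem primrec_testBound {f g h : α → ℕ} (hf : Primrec f) (hg : Primrec g) (hh : Primrec h) :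
    Primrec fun a => testBound (f a) (g a) (h a) :=
  Primrec.nat_add.comp (.const 1) (Primrec.nat_mul.comp hg (Primrec.nat_mul.comp
    (primrec_nat_pow.comp (.const 2) (Primrec.nat_mul.comp hh hf)) hf))

theorem primrec_states {t : α → Table} (ht : Primrec t) : Primrec fun a => (t a).states :=
  Primrec.list_length.comp (Primrec.snd.comp (Primrec.snd.comp ht))

theorem primrec_inputBound {I : α → ℕ × List ℕ × Table × Table × Table} {C : α → ℕ}
    (hI : Primrec I) (hC : Primrec C) : Primrec fun a => inputBound (I a) (C a) := by
  have ha : Primrec fun a => (I a).2.1 := Primrec.fst.comp (Primrec.snd.comp hI)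
  have hA : Primrec fun a => (I a).2.2.1.states + 1 := Primrec.succ.comp (primrec_states
    (Primrec.fst.comp (Primrec.snd.comp (Primrec.snd.comp hI))))
  have hP : Primrec fun a => (I a).2.2.2.2.states + 1 := Primrec.succ.comp (primrec_states
    (Primrec.snd.comp (Primrec.snd.comp (Primrec.snd.comp (Primrec.snd.comp hI)))))
  exact primrec_afterBound hA (primrec_newBound hA (primrec_sumBound hA hP
    (Primrec.list_length.comp ha) (primrec_sum ha))) hC

theorem primrec_getD {β : Type} [Primcodable β] {w : α → List β} {i : α → ℕ} (d : β)
    (hw : Primrec w) (hi : Primrec i) : Primrec fun a => (w a).getD (i a) d :=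
  (Primrec.list_getD d).comp hw hi

theorem primrec_runTable {t : α → Table} {w : α → List ℕ} (ht : Primrec t) (hw : Primrec w) :
    Primrec fun a => runTable (t a) (w a) := by
  refine primrec_getD 0 (Primrec.snd.comp (Primrec.snd.comp ht)) ?_
  refine Primrec.list_foldl (h := fun a p => ((t a).2.1.getD p.1 []).getD p.2 0) hw
    (Primrec.fst.comp ht) ?_
  exact primrec_getD 0 (primrec_getD [] (Primrec.fst.comp (Primrec.snd.comp (ht.comp .fst)))
    (Primrec.fst.comp .snd)) (Primrec.snd.comp .snd)

theorem primrecPred_wellFormed {b : α → ℕ} {t : α → Table} (hb : Primrec b) (ht : Primrec t) :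
    PrimrecPred fun a => (t a).WellFormed (b a) := by
  have hs := primrec_states ht
  have h1 : PrimrecRel fun (q : ℕ) (p : ℕ × ℕ) => q < p.2 :=
    Primrec.nat_lt.comp .fst (Primrec.snd.comp .snd)
  have h2 : PrimrecRel fun (r : List ℕ) (p : ℕ × ℕ) => r.length = p.1 ∧ ∀ q ∈ r, q < p.2 :=
    (Primrec.eq.comp (Primrec.list_length.comp .fst) (Primrec.fst.comp .snd)).and
      (h1.forall_mem_list.comp .fst .snd)
  exact (Primrec.nat_lt.comp (Primrec.fst.comp ht) hs).and
    ((Primrec.eq.comp (Primrec.list_length.comp (Primrec.fst.comp (Primrec.snd.comp ht))) hs).and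
      (h2.forall_mem_list.comp (Primrec.fst.comp (Primrec.snd.comp ht)) (hb.pair hs)))

theorem primrec_paddedDigit {L p : α → ℕ} {w : α → List ℕ} (hL : Primrec L) (hw : Primrec w)
    (hp : Primrec p) : Primrec fun a => paddedDigit (L a) (w a) (p a) := by
  have h := Primrec.nat_add.comp hp (Primrec.list_length.comp hw)
  exact Primrec.ite (Primrec.nat_lt.comp h hL) (.const 0)
    (primrec_getD 0 hw (Primrec.nat_sub.comp h hL))

theorem primrec_succWord {b : α → ℕ} {u v : α → List ℕ} (hb : Primrec b) (hu : Primrec u)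
    (hv : Primrec v) : Primrec fun a => succWord (b a) (u a) (v a) := by
  have h1 {β : Type} [Primcodable β] {u : α → β} (hu : Primrec u) :
      Primrec fun q : α × ℕ => u q.1 := hu.comp .fst
  have hL := h1 (Primrec.list_length.comp hv)
  refine Primrec.list_map (g := fun a p => paddedDigit (v a).length (u a) p +
    paddedDigit (v a).length [1] p * b a + paddedDigit (v a).length (v a) p * (b a * b a))
    (Primrec.list_range.comp (Primrec.list_length.comp hv)) ?_
  exact Primrec.nat_add.comp (Primrec.nat_add.comp (primrec_paddedDigit hL (h1 hu) .snd)
    (Primrec.nat_mul.comp (primrec_paddedDigit hL (.const [1]) .snd) (h1 hb)))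
    (Primrec.nat_mul.comp (primrec_paddedDigit hL (h1 hv) .snd)
      (Primrec.nat_mul.comp (h1 hb) (h1 hb)))

theorem primrecPred_isSuccWord {b : α → ℕ} {t : α → Table} {u v : α → List ℕ} (hb : Primrec b)
    (ht : Primrec t) (hu : Primrec u) (hv : Primrec v) :
    PrimrecPred fun a => IsSuccWord (b a) (t a) (u a) (v a) :=
  (Primrec.nat_le.comp (Primrec.list_length.comp hu) (Primrec.list_length.comp hv)).and
    ((Primrec.eq.comp (Primrec.list_headI.comp hv) (.const 0)).not.and
      ((Primrec.nat_lt.forall_mem_list.comp hv hb).and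
        (Primrec.eq.comp (primrec_runTable ht (primrec_succWord hb hu hv)) (.const 1))))

theorem primrec_tableSum {t : α → Table} {W : α → List (List ℕ)} {n i : α → ℕ} (ht : Primrec t)
    (hW : Primrec W) (hn : Primrec n) (hi : Primrec i) :
    Primrec fun a => tableSum (t a) (W a) (n a) (i a) := by
  refine primrec_sum (Primrec.list_map (g := fun a j => runTable (t a) ((W a).getD (i a + j) []))
    (Primrec.list_range.comp hn) ?_)
  exact primrec_runTable (ht.comp .fst) (primrec_getD [] (hW.comp .fst)
    (Primrec.nat_add.comp (hi.comp .fst) .snd))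

theorem primrec_tableCount {t : α → Table} {W : α → List (List ℕ)} {K n : α → ℕ} (ht : Primrec t)
    (hW : Primrec W) (hK : Primrec K) (hn : Primrec n) :
    Primrec fun a => tableCount (t a) (W a) (K a) (n a) := by
  have h1 : PrimrecRel fun (i : ℕ) (a : α) =>
      ∀ i' < i, tableSum (t a) (W a) (n a) i' ≠ tableSum (t a) (W a) (n a) i := by
    refine primrecPred_forall_lt (α := ℕ × α) (f := Prod.fst) (p := fun q i' =>
      tableSum (t q.2) (W q.2) (n q.2) i' ≠ tableSum (t q.2) (W q.2) (n q.2) q.1) ?_ .fst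
    have h2 : Primrec fun q : (ℕ × α) × ℕ => q.1.2 := Primrec.snd.comp .fst
    exact (Primrec.eq.comp (primrec_tableSum (ht.comp h2) (hW.comp h2) (hn.comp h2) .snd)
      (primrec_tableSum (ht.comp h2) (hW.comp h2) (hn.comp h2) (Primrec.fst.comp .fst))).not
  exact Primrec.list_length.comp (h1.listFilter.comp (Primrec.list_range.comp hK) .id)

theorem primrecRel_certifies : PrimrecRel Certifies := by
  have hI : Primrec fun p : (ℕ × List ℕ × Table × Table × Table) ×
      (ℕ × ℕ × List (List ℕ) × Table) => p.1 := .fst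
  have hc : Primrec fun p : (ℕ × List ℕ × Table × Table × Table) ×
      (ℕ × ℕ × List (List ℕ) × Table) => p.2 := .snd
  have hb := Primrec.fst.comp hI
  have hA := Primrec.fst.comp (Primrec.snd.comp (Primrec.snd.comp hI))
  have hM := Primrec.fst.comp (Primrec.snd.comp (Primrec.snd.comp (Primrec.snd.comp hI)))
  have hK₁ := Primrec.fst.comp hc
  have hK₂ := Primrec.fst.comp (Primrec.snd.comp hc)
  have hW := Primrec.fst.comp (Primrec.snd.comp (Primrec.snd.comp hc))
  have ht := Primrec.snd.comp (Primrec.snd.comp (Primrec.snd.comp hc))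
  have hsA := Primrec.succ.comp (primrec_states hA)
  have hE := primrec_inputBound hI (primrec_sum (Primrec.snd.comp (Primrec.snd.comp ht)))
  have hT := primrec_testBound hsA (primrec_states ht) hE
  refine (primrecPred_wellFormed hb ht).and ((Primrec.eq.comp (primrec_getD [] hW (.const 0))
    (.const [])).and (PrimrecPred.and ?_ ((Primrec.nat_lt.comp hT (Primrec.list_length.comp
      (primrec_getD [] hW hK₁))).and ((Primrec.nat_lt.comp (Primrec.nat_add.comp hT
        (Primrec.nat_mul.comp hE hsA)) (Primrec.list_length.comp (primrec_getD [] hW hK₂))).and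
          ?_))))
  · exact primrecPred_forall_lt (primrecPred_isSuccWord (hb.comp .fst) (hA.comp .fst)
      (primrec_getD [] (hW.comp .fst) .snd)
      (primrec_getD [] (hW.comp .fst) (Primrec.succ.comp .snd))) (Primrec.nat_add.comp hK₁ hK₂)
  · exact primrecPred_forall_lt (Primrec.eq.comp (primrec_runTable (ht.comp .fst)
      (primrec_getD [] (hW.comp .fst) .snd)) (primrec_tableCount (hM.comp .fst) (hW.comp .fst)
        (hK₂.comp .fst) .snd)) hK₁

/-- Unbounded search for a certificate: if `R` is a primitive recursive relation, some partial
recursive function returns, for every `a` that has a certificate, the content `g c` of a certificate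
`c`. -/
theorem exists_partrec_search {β γ : Type} [Primcodable β] [Primcodable γ] {R : α → β → Prop}
    {g : β → γ} (hR : PrimrecRel R) (hg : Primrec g) :
    ∃ f : α →. γ, Partrec f ∧ ∀ a, (∃ c, R a c) → ∃ c, R a c ∧ g c ∈ f a := by
  classical
  let F : α → ℕ → Option γ := fun a n => (Encodable.decode n : Option β).bind fun c =>
    if R a c then some (g c) else none
  refine ⟨fun a => Nat.rfindOpt (F a), ?_, fun a ⟨c, hc⟩ => ?_⟩
  · refine Partrec.rfindOpt (Primrec₂.to_comp (Primrec.bind_decode_iff.2 ?_))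
    exact Primrec.ite hR (Primrec.option_some.comp (hg.comp .snd)) (.const none)
  · have hd : (Nat.rfindOpt (F a)).Dom :=
      Nat.rfindOpt_dom.2 ⟨Encodable.encode c, g c, by simp [F, hc]⟩
    obtain ⟨n, hn⟩ := Nat.rfindOpt_spec (Part.get_mem hd)
    obtain ⟨c', -, h⟩ := Option.bind_eq_some_iff.1 hn
    split_ifs at h with hR'
    refine ⟨c', hR', ?_⟩
    rw [Option.some.inj h]
    exact Part.get_mem hd

end Computability

end AddCompl

open AddCompl
theorem mainTheorem1 :
    (∀ (S : NumSys) (k : ℕ) (a : Fin k → ℕ) (x : ℕ → ℕ),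
      S.IsAdditive → StrictMono a → (∀ n, ∃ i, x n = a i) →
      S.IsAutomatic x →
      (∃ C, ∀ n, additiveComplexity x n ≤ C) →
      S.IsSynchronized (prefixParikh a x) →
      S.IsAutomatic (additiveComplexity x)) ∧
    ∃ f : ℕ × List ℕ × Table × Table × Table →. Table, Partrec f ∧
      ∀ (S : NumSys) (k : ℕ) (a : Fin k → ℕ) (x : ℕ → ℕ) (b s₁ s₂ s₃ : ℕ)
        (A : DFA (Fin 3 → Fin b) (Fin s₁)) (M : DFAO (Fin b) (Fin s₂) ℕ)
        (P : DFA (Fin (k + 1) → Fin b) (Fin s₃)),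
        StrictMono a → (∀ n, ∃ i, x n = a i) →
        S.Recognizes A additionGraph →
        S.Computes M x →
        (∃ C, ∀ n, additiveComplexity x n ≤ C) →
        S.Recognizes P (vectorGraph (prefixParikh a x)) →
        ∃ (s : ℕ) (N : DFAO (Fin b) (Fin s) ℕ),
          digitTable N ∈ f (b, List.ofFn a, tupleTable A, digitTable M, tupleTable P) ∧
          S.Computes N (additiveComplexity x) := by
  constructor
  -- the automata for addition and for the Parikh vectors may have different digit alphabets
  · rintro S k a x ⟨b, s₁, A, hA⟩ ha hx - hC ⟨b', s₃, P, hP⟩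
    have : NeZero b := ⟨by have := hA.one_lt; omega⟩
    have hb' : ∀ n, ∀ d ∈ S.rep n, d < b' := fun n =>
      hP.digit_lt (v := Fin.cons n (prefixParikh a x n)) (fun i => by simp) 0
    have : NeZero b' := ⟨by
      have := hb' 1 1 (by simp [NumSys.rep_one])
      omega⟩
    obtain ⟨s, N, hN⟩ := NumSys.exists_dfao ha hx hA.isRec hA.hasValid
      (hP.isRec.changeBase hb' (NeZero.pos b')) hC
    exact ⟨b, s, N, NumSys.computes_of_forall hA.rep_lt hN⟩
  · have ht : Primrec fun c : ℕ × ℕ × List (List ℕ) × Table => c.2.2.2 :=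
      Primrec.snd.comp (Primrec.snd.comp .snd)
    obtain ⟨f, hf, hf'⟩ := exists_partrec_search primrecRel_certifies ht
    refine ⟨f, hf, fun S k a x b s₁ s₂ s₃ A M P ha hx hA hM hC hP => ?_⟩
    obtain ⟨c, hc, hfc⟩ := hf' _ (exists_certifies ha hx hA hM hC hP)
    obtain ⟨s, N, hN, hNc⟩ := hc.computes ha hx hA hM hP
    exact ⟨s, N, hN ▸ hfc, hNc⟩
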